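/- Conventions. Let $M$ be a von Neumann algebra on a complex Hilbert space $\mathcal H$, with commutant $M'$. A vector $\Psi\in\mathcal H$ is cyclic for $M$ if $\{O\Psi : O\in M\}$ is dense in $\mathcal H$, and separating for $M$ if $O\in M$, $O\Psi=0$ imply $O=0$. For $\Psi$ cyclic and separating for $M$ and any $\Phi\in\mathcal H$, the relative Tomita operator $S_{\Psi|\Phi}$ is the closed, densely defined, conjugate-linear operator with $S_{\Psi|\Phi}x=y$ whenever there is a sequence $O_n\in M$ with $O_n\Psi\to x$ and $O_n^\dagger\Phi\to y$; the relative modular operator is $\Delta_{\Psi|\Phi}=S_{\Psi|\Phi}^\dagger S_{\Psi|\Phi}$, a positive self-adjoint operator. The relative entropy is $$\mathcal S_{\Psi|\Phi}(M)=-\langle\Psi|\log\Delta_{\Psi|\Phi}|\Psi\rangle=-\int_{[0,\infty)}\log\lambda\; d\langle\Psi|P_\lambda|\Psi\rangle\in[-\infty,+\infty],$$ where $P$ is the unique projection valued measure on $\mathbb R$ with $\Delta_{\Psi|\Phi}=\int\lambda\,dP_\lambda$ and $\log 0=-\infty$. Theorem. Let $u:\mathcal H_{code}\to\mathcal H_{phys}$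 be a linear isometry between two complex Hilbert spaces, and let $M_{code}$ and $M_{phys}$ be von Neumann algebras on $\mathcal H_{code}$ and $\mathcal H_{phys}$, with commutants $M_{code}'$ and $M_{phys}'$. Suppose that * there exists $\Omega\in\mathcal H_{code}$ such that $u\Omega$ is cyclic and separating for $M_{phys}$; * for all $O\in M_{code}$ and $O'\in M_{code}'$ there exist $\tilde O\in M_{phys}$ and $\tilde O'\in M_{phys}'$ such that for all $\Theta\in\mathcal H_{code}$ $$uO\Theta=\tilde O u\Theta,\quad uO'\Theta=\tilde O'u\Theta,\quad uO^\dagger\Theta=\tilde O^\dagger u\Theta,\quad uO'^\dagger\Theta=\tilde O'^\dagger u\Theta .$$ Then for all $\Psi,\Phi\in\mathcal H_{code}$ with $\Psi$ cyclic and separating for $M_{code}$: * $u\Psi$ is cyclic and separating for $M_{phys}$ and for $M_{phys}'$; * the relative entropies below are well defined, and $$\mathcal S_{\Psi|\Phi}(M_{code})=\mathcal S_{u\Psi|u\Phi}(M_{phys}),\qquad \mathcal S_{\Psi|\Phi}(M_{code}')=\mathcal S_{u\Psi|u\Phi}(M_{phys}').$$ -/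

import Mathlib

open scoped ENNReal InnerProductSpace

/-! ### Cyclic and separating vectors -/

section Vectors

variable {H : Type*} [NormedAddCommGroup H] [InnerProductSpace ℂ H] [CompleteSpace H]

/-- `Ψ` is cyclic for `M`: the vectors `O Ψ` with `O ∈ M` are dense. -/
def IsCyclicVector (M : VonNeumannAlgebra H) (Ψ : H) : Prop :=
  Dense {x : H | ∃ O ∈ M, O Ψ = x}

/-- `Ψ` is separating for `M`: zero is the only element of `M` that annihilates `Ψ`. -/
def IsSeparatingVector (M : VonNeumannAlgebra H) (Ψ : H) : Prop :=
  ∀ O ∈ M, O Ψ = 0 → O = 0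

/-! ### The relative Tomita operator and the relative modular operator -/

/-- The graph of the relative Tomita operator `S_{Ψ|Φ}`: the pairs `(x, y)` for which some sequence
`O n` in `M` satisfies `O n Ψ → x` and `(O n)† Φ → y`. For `Ψ` cyclic and separating this is the
graph of a closed densely defined conjugate-linear operator. -/
def relativeTomitaGraph (M : VonNeumannAlgebra H) (Ψ Φ : H) : Set (H × H) :=
  {p | ∃ O : ℕ → (H →L[ℂ] H), (∀ n, O n ∈ M) ∧
    Filter.Tendsto (fun n => O n Ψ) Filter.atTop (nhds p.1) ∧
    Filter.Tendsto (fun n => (star (O n)) Φ) Filter.atTop (nhds p.2)}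

/-- The graph of the adjoint of a conjugate-linear operator with graph `S`: the pairs `(φ, η)` with
`⟪φ, S x⟫ = conj ⟪η, x⟫` for all `x` in the domain of `S`. -/
def conjAdjointGraph (S : Set (H × H)) : Set (H × H) :=
  {q | ∀ p ∈ S, ⟪q.1, p.2⟫_ℂ = (starRingEnd ℂ) ⟪q.2, p.1⟫_ℂ}

theorem relativeTomitaGraph_zero (M : VonNeumannAlgebra H) (Ψ Φ : H) :
    ((0 : H), (0 : H)) ∈ relativeTomitaGraph M Ψ Φ :=
  ⟨fun _ => 0, fun _ => zero_mem M, by simp, by simp⟩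

theorem relativeTomitaGraph_add {M : VonNeumannAlgebra H} {Ψ Φ x y x' y' : H}
    (h : (x, y) ∈ relativeTomitaGraph M Ψ Φ) (h' : (x', y') ∈ relativeTomitaGraph M Ψ Φ) :
    (x + x', y + y') ∈ relativeTomitaGraph M Ψ Φ := by
  obtain ⟨O, hO, h1, h2⟩ := h
  obtain ⟨O', hO', h1', h2'⟩ := h'
  exact ⟨fun n => O n + O' n, fun n => add_mem (hO n) (hO' n),
    by simpa using h1.add h1', by simpa using h2.add h2'⟩

theorem relativeTomitaGraph_smul {M : VonNeumannAlgebra H} {Ψ Φ x y : H} (c : ℂ)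
    (h : (x, y) ∈ relativeTomitaGraph M Ψ Φ) :
    (c • x, (starRingEnd ℂ) c • y) ∈ relativeTomitaGraph M Ψ Φ := by
  obtain ⟨O, hO, h1, h2⟩ := h
  refine ⟨fun n => c • O n, fun n => M.toStarSubalgebra.smul_mem (hO n) c,
    by simpa using h1.const_smul c, ?_⟩
  simpa [star_smul] using h2.const_smul ((starRingEnd ℂ) c)

/-- The graph of `S_{Ψ|Φ}† S_{Ψ|Φ}`: the pairs `(x, z)` such that `x` is in the domain of
`S_{Ψ|Φ}`, `S_{Ψ|Φ} x` is in the domain of the adjoint, and the adjoint maps it to `z`. -/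
def relativeModularGraph (M : VonNeumannAlgebra H) (Ψ Φ : H) : Submodule ℂ (H × H) where
  carrier := {p | ∃ y : H, (p.1, y) ∈ relativeTomitaGraph M Ψ Φ ∧
    (y, p.2) ∈ conjAdjointGraph (relativeTomitaGraph M Ψ Φ)}
  zero_mem' := ⟨0, relativeTomitaGraph_zero M Ψ Φ, fun p _ => by simp⟩
  add_mem' := by
    rintro p p' ⟨y, hy, hz⟩ ⟨y', hy', hz'⟩
    refine ⟨y + y', relativeTomitaGraph_add hy hy', fun q hq => ?_⟩
    have e1 := hz q hq
    have e2 := hz' q hq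
    simp only at e1 e2
    simp only [Prod.snd_add, inner_add_left, map_add, e1, e2]
  smul_mem' := by
    rintro c p ⟨y, hy, hz⟩
    refine ⟨(starRingEnd ℂ) c • y, relativeTomitaGraph_smul c hy, fun q hq => ?_⟩
    have e := hz q hq
    simp only at e
    simp only [Prod.smul_snd, inner_smul_left, map_mul, e]

/-- The relative modular operator `Δ_{Ψ|Φ} = S_{Ψ|Φ}† S_{Ψ|Φ}`, as a partially defined operator. -/
noncomputable def relativeModularOperator (M : VonNeumannAlgebra H) (Ψ Φ : H) : H →ₗ.[ℂ] H :=
  (relativeModularGraph M Ψ Φ).toLinearPMap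

end Vectors

/-! ### Projection valued measures -/

/-- A projection valued measure on the Borel sets of `ℝ`, extended by zero to other sets. -/
structure ProjectionValuedMeasure (H : Type*) [NormedAddCommGroup H] [InnerProductSpace ℂ H]
    [CompleteSpace H] where
  /-- The projection attached to a set. -/
  proj : Set ℝ → (H →L[ℂ] H)
  isStarProjection' : ∀ s, MeasurableSet s → IsStarProjection (proj s)
  not_measurable' : ∀ s, ¬ MeasurableSet s → proj s = 0
  empty' : proj ∅ = 0
  univ' : proj Set.univ = 1
  inter' : ∀ s t, MeasurableSet s → MeasurableSet t → proj s * proj t = proj (s ∩ t)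
  iUnion' : ∀ s : ℕ → Set ℝ, (∀ n, MeasurableSet (s n)) →
    (∀ m n, m ≠ n → s m ∩ s n = ∅) → ∀ x : H,
      Filter.Tendsto (fun N : ℕ => ∑ n ∈ Finset.range N, proj (s n) x) Filter.atTop
        (nhds (proj (⋃ n, s n) x))

namespace ProjectionValuedMeasure

variable {H : Type*} [NormedAddCommGroup H] [InnerProductSpace ℂ H] [CompleteSpace H]

theorem re_inner_nonneg (P : ProjectionValuedMeasure H) (x : H) {s : Set ℝ}
    (hs : MeasurableSet s) : 0 ≤ (⟪x, P.proj s x⟫_ℂ).re := by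
  have hp := P.isStarProjection' s hs
  have h1 : P.proj s (P.proj s x) = P.proj s x := by
    have h := congrArg (fun T : H →L[ℂ] H => T x) hp.isIdempotentElem.eq
    simpa using h
  have h2 : ⟪P.proj s x, P.proj s x⟫_ℂ = ⟪x, P.proj s (P.proj s x)⟫_ℂ := by
    have h := ContinuousLinearMap.adjoint_inner_left (P.proj s) (P.proj s x) x
    rwa [← ContinuousLinearMap.star_eq_adjoint, hp.isSelfAdjoint.star_eq] at h
  have h3 : 0 ≤ (⟪P.proj s x, P.proj s x⟫_ℂ).re := inner_self_nonneg (𝕜 := ℂ)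
  rwa [h2, h1] at h3

/-- The Borel measure `B ↦ ⟪x, P_B x⟫` on `ℝ`. -/
noncomputable def scalarMeasure (P : ProjectionValuedMeasure H) (x : H) :
    MeasureTheory.Measure ℝ :=
  MeasureTheory.Measure.ofMeasurable (fun s _ => ENNReal.ofReal (⟪x, P.proj s x⟫_ℂ).re)
    (by simp [P.empty']) (by
      intro s hs hd
      have hdisj : ∀ m n, m ≠ n → s m ∩ s n = ∅ := fun m n hmn =>
        Set.disjoint_iff_inter_eq_empty.mp (hd hmn)
      have ht : Filter.Tendsto
          (fun N : ℕ => ∑ n ∈ Finset.range N, (⟪x, P.proj (s n) x⟫_ℂ).re) Filter.atTop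
          (nhds (⟪x, P.proj (⋃ n, s n) x⟫_ℂ).re) := by
        have h := (Complex.continuous_re.tendsto _).comp
          ((tendsto_const_nhds (x := x)).inner (𝕜 := ℂ) (P.iUnion' s hs hdisj x))
        refine h.congr fun N => ?_
        simp [inner_sum, Complex.re_sum]
      have hsum : HasSum (fun n => (⟪x, P.proj (s n) x⟫_ℂ).re)
          (⟪x, P.proj (⋃ n, s n) x⟫_ℂ).re :=
        (hasSum_iff_tendsto_nat_of_nonneg (fun n => P.re_inner_nonneg x (hs n)) _).mpr ht
      rw [← hsum.tsum_eq]
      exact ENNReal.ofReal_tsum_of_nonneg (fun n => P.re_inner_nonneg x (hs n)) hsum.summable)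

/-- `A = ∫ t dP(t)`: the domain of `A` is the set of all `x` with `∫ t² d⟪x, P x⟫ < ∞`, and
`⟪x, A x⟫ = ∫ t d⟪x, P x⟫` on it (by polarization, this determines `A`). -/
def IsSpectralMeasureOf (P : ProjectionValuedMeasure H) (A : H →ₗ.[ℂ] H) : Prop :=
  (∀ x : H, x ∈ A.domain ↔ ∫⁻ t, ENNReal.ofReal (t ^ 2) ∂(P.scalarMeasure x) < ∞) ∧
  ∀ x : A.domain, ⟪(x : H), A x⟫_ℂ = ((∫ t, t ∂(P.scalarMeasure (x : H)) : ℝ) : ℂ)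

/-- `∫_{[0,∞)} log t d⟪x, P x⟫` as an extended real number, with `log 0 = -∞`: the integral of the
positive part of the logarithm minus the integral of its negative part. -/
noncomputable def logIntegral (P : ProjectionValuedMeasure H) (x : H) : EReal :=
  ((∫⁻ t in Set.Ici (0 : ℝ), (ENNReal.log (ENNReal.ofReal t)).toENNReal
      ∂(P.scalarMeasure x) : ℝ≥0∞) : EReal) -
  ((∫⁻ t in Set.Ici (0 : ℝ), (-ENNReal.log (ENNReal.ofReal t)).toENNReal
      ∂(P.scalarMeasure x) : ℝ≥0∞) : EReal)

end ProjectionValuedMeasure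

/-! ### Relative entropy -/

/-- `s` is the relative entropy `-⟪Ψ, log Δ_{Ψ|Φ} Ψ⟫` with respect to `M`: the vector `Ψ` is cyclic
and separating for `M`, the relative modular operator has exactly one spectral measure `P`, and
`s = -∫ log t d⟪Ψ, P Ψ⟫`. In particular there is at most one such `s`. -/
def IsRelativeEntropy {H : Type*} [NormedAddCommGroup H] [InnerProductSpace ℂ H] [CompleteSpace H]
    (M : VonNeumannAlgebra H) (Ψ Φ : H) (s : EReal) : Prop :=
  IsCyclicVector M Ψ ∧ IsSeparatingVector M Ψ ∧
  ∃ P : ProjectionValuedMeasure H,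
    P.IsSpectralMeasureOf (relativeModularOperator M Ψ Φ) ∧
    (∀ Q : ProjectionValuedMeasure H,
      Q.IsSpectralMeasureOf (relativeModularOperator M Ψ Φ) → Q = P) ∧
    s = -P.logIntegral Ψ

/-!
The isometry `u` carries the graph of `S_{Ψ|Φ}` for `M_code` into the one for `M_phys`, and likewise
for the commutants. The adjoint of `S_{Ψ|Φ}` is the relative Tomita operator of the commutant: for
`(y, z)` in its graph, the required operators of the commutant are corners of the projections onto
the closures of the `M`-invariant graphs `{(O Ψ, e O y)}`, `e → 0`. So `u` intertwines the operators
`Δ_{Ψ|Φ} = S† S`.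

An intertwining operator has zero matrix entries between spectral subspaces of disjoint intervals,
since a quadratic form with values in `[a, b]` bounds the distance of the operator to the midpoint;
hence it commutes with the spectral projections. This identifies the spectral measures at `Ψ` and
`u Ψ`, and for the identity operator it gives uniqueness. The spectral measure of `Δ` exists because
`(1 + Δ)⁻¹` is bounded and self-adjoint: push its spectral measure forward along `t ↦ t⁻¹ - 1`.

If `T ∈ M_phys` kills `u Ψ`, then it kills `T' u Ψ = u O' Ψ` for `O' ∈ M_code'`, hence the range of
`u`, hence the separating vector `u Ω`, so `T = 0`.
-/

/-! ### Limits in Hilbert spaces -/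

section HilbertLimits

open Filter Topology

variable {E : Type*} [NormedAddCommGroup E] [InnerProductSpace ℂ E] {ι : Type*} {l : Filter ι}

theorem tendsto_apply_of_norm_le {T : ι → E →L[ℂ] E} {S : E →L[ℂ] E} {s : Set E}
    (hT : ∀ i x, ‖T i x‖ ≤ ‖x‖) (hs : Dense s)
    (h : ∀ x ∈ s, Tendsto (T · x) l (𝓝 (S x))) (x : E) : Tendsto (T · x) l (𝓝 (S x)) := by
  have hequi : Equicontinuous fun i x => T i x :=
    (LipschitzWith.uniformEquicontinuous (fun i x => T i x) 1 fun i =>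
      (T i).lipschitz.weaken ((T i).opNorm_le_bound zero_le_one (by simpa using hT i)))
      |>.equicontinuous
  exact closure_minimal h (hequi.isClosed_setOfPred_tendsto S.continuous) (hs x)

theorem tendsto_of_tendsto_inner_of_norm_le {b : ι → E} {y : E} {s : Set E}
    (hb : ∀ i, ‖b i‖ ≤ ‖y‖) (hy : y ∈ closure s)
    (h : ∀ v ∈ s, Tendsto (fun i => ⟪v, b i⟫_ℂ) l (𝓝 ⟪v, y⟫_ℂ)) : Tendsto b l (𝓝 y) := by
  have hequi : Equicontinuous fun i (v : E) => ⟪v, b i⟫_ℂ :=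
    (LipschitzWith.uniformEquicontinuous _ ‖y‖₊ fun i =>
      LipschitzWith.of_dist_le_mul fun v w => by
        rw [dist_eq_norm, dist_eq_norm, ← inner_sub_left, mul_comm]
        exact (norm_inner_le_norm _ _).trans (by gcongr; exact hb i)).equicontinuous
  have hweak : Tendsto (fun i => ⟪y, b i⟫_ℂ) l (𝓝 ⟪y, y⟫_ℂ) :=
    closure_minimal h (hequi.isClosed_setOfPred_tendsto (f := fun v => ⟪v, y⟫_ℂ) (by fun_prop)) hy
  have hre : Tendsto (fun i => 2 * (RCLike.re ⟪y, y⟫_ℂ - RCLike.re ⟪y, b i⟫_ℂ)) l (𝓝 0) := by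
    simpa using (((Complex.continuous_re.tendsto _).comp hweak).const_sub
      (RCLike.re ⟪y, y⟫_ℂ)).const_mul 2
  have hsq : Tendsto (fun i => ‖b i - y‖ ^ 2) l (𝓝 0) := by
    refine squeeze_zero (fun i => by positivity) (fun i => ?_) hre
    rw [norm_sub_rev, norm_sub_sq (𝕜 := ℂ), inner_self_eq_norm_sq]
    linarith [pow_le_pow_left₀ (norm_nonneg _) (hb i) 2]
  rw [tendsto_iff_norm_sub_tendsto_zero]
  simpa [Function.comp_def] using (Real.continuous_sqrt.tendsto 0).comp hsq

end HilbertLimits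

/-! ### Cyclic vectors and commutants -/

section Orbit

variable {H : Type*} [NormedAddCommGroup H] [InnerProductSpace ℂ H] [CompleteSpace H]

theorem star_inner_left (T : H →L[ℂ] H) (x y : H) : ⟪star T x, y⟫_ℂ = ⟪x, T y⟫_ℂ :=
  ContinuousLinearMap.adjoint_inner_left T y x

theorem star_inner_right (T : H →L[ℂ] H) (x y : H) : ⟪x, star T y⟫_ℂ = ⟪T x, y⟫_ℂ :=
  ContinuousLinearMap.adjoint_inner_right T x y

/-- The subspace `M v` of all `O v` with `O ∈ M`. -/
def vonNeumannOrbit (M : VonNeumannAlgebra H) (v : H) : Submodule ℂ H where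
  carrier := {x : H | ∃ O ∈ M, O v = x}
  zero_mem' := ⟨0, zero_mem M, rfl⟩
  add_mem' := by
    rintro _ _ ⟨O, hO, rfl⟩ ⟨O', hO', rfl⟩
    exact ⟨O + O', add_mem hO hO', rfl⟩
  smul_mem' := by
    rintro c _ ⟨O, hO, rfl⟩
    exact ⟨c • O, M.toStarSubalgebra.smul_mem hO c, rfl⟩

variable {M : VonNeumannAlgebra H} {v : H}

theorem apply_mem_closure_vonNeumannOrbit {O : H →L[ℂ] H} (hO : O ∈ M) (v : H) :
    O v ∈ (vonNeumannOrbit M v).topologicalClosure :=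
  Submodule.le_topologicalClosure _ ⟨O, hO, rfl⟩

theorem starProjection_vonNeumannOrbit_self (M : VonNeumannAlgebra H) (v : H) :
    (vonNeumannOrbit M v).topologicalClosure.starProjection v = v :=
  Submodule.starProjection_eq_self_iff.mpr (apply_mem_closure_vonNeumannOrbit (one_mem M) v)

theorem apply_comm_of_mem_commutant {O T : H →L[ℂ] H} (hO : O ∈ M) (hT : T ∈ M.commutant)
    (x : H) : O (T x) = T (O x) :=
  DFunLike.congr_fun (VonNeumannAlgebra.mem_commutant_iff.mp hT O hO) x

theorem starProjection_vonNeumannOrbit_mem (M : VonNeumannAlgebra H) (v : H) :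
    (vonNeumannOrbit M v).topologicalClosure.starProjection ∈ M.commutant := by
  rw [VonNeumannAlgebra.IsStarProjection.mem_iff isStarProjection_starProjection]
  intro T hT
  rw [VonNeumannAlgebra.commutant_commutant] at hT
  rw [Submodule.range_starProjection, Module.End.mem_invtSubmodule]
  intro x hx
  refine map_mem_closure T.continuous hx ?_
  rintro _ ⟨O, hO, rfl⟩
  exact ⟨T * O, mul_mem hT hO, rfl⟩

theorem IsCyclicVector.isSeparatingVector_commutant (h : IsCyclicVector M v) :
    IsSeparatingVector M.commutant v := by
  intro T hT hTv
  refine DFunLike.coe_injective (Continuous.ext_on h T.continuous continuous_const ?_)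
  rintro _ ⟨O, hO, rfl⟩
  rw [← apply_comm_of_mem_commutant hO hT, hTv, map_zero, zero_apply]

theorem IsSeparatingVector.isCyclicVector_commutant (h : IsSeparatingVector M v) :
    IsCyclicVector M.commutant v := by
  set K := (vonNeumannOrbit M.commutant v).topologicalClosure
  have hP : K.starProjection ∈ M := by
    simpa using starProjection_vonNeumannOrbit_mem M.commutant v
  have hK : 1 - K.starProjection = 0 :=
    h _ (sub_mem (one_mem M) hP) (by simp [K, starProjection_vonNeumannOrbit_self])
  intro x
  have hx : K.starProjection x = x := (sub_eq_zero.mp (DFunLike.congr_fun hK x)).symm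
  exact Submodule.starProjection_eq_self_iff.mp hx

theorem IsSeparatingVector.isCyclicVector (h : IsSeparatingVector M.commutant v) :
    IsCyclicVector M v := by
  simpa using h.isCyclicVector_commutant

end Orbit

/-! ### The adjoint of the relative Tomita operator -/

section TomitaAdjoint

open Filter Topology

theorem isClosed_conjAdjointGraph {E : Type*} [NormedAddCommGroup E] [InnerProductSpace ℂ E]
    (S : Set (E × E)) : IsClosed (conjAdjointGraph S) := by
  simp only [conjAdjointGraph, Set.ofPred_forall]
  exact isClosed_iInter fun p => isClosed_iInter fun _ =>
    isClosed_eq (by fun_prop) (Complex.continuous_conj.comp (by fun_prop))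

variable {H : Type*} [NormedAddCommGroup H] [InnerProductSpace ℂ H] [CompleteSpace H]
  {M : VonNeumannAlgebra H} {Ψ Φ y z : H}

theorem relativeTomitaGraph_eq_closure (M : VonNeumannAlgebra H) (Ψ Φ : H) :
    relativeTomitaGraph M Ψ Φ = closure {q : H × H | ∃ O ∈ M, (O Ψ, star O Φ) = q} := by
  ext p
  rw [mem_closure_iff_seq_limit]
  constructor
  · rintro ⟨O, hO, hfst, hsnd⟩
    exact ⟨fun n => (O n Ψ, star (O n) Φ), fun n => ⟨O n, hO n, rfl⟩, hfst.prodMk_nhds hsnd⟩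
  · rintro ⟨q, hq, hlim⟩
    choose O hO hOq using hq
    obtain rfl : (fun n => (O n Ψ, star (O n) Φ)) = q := funext hOq
    exact ⟨O, hO, (continuous_fst.tendsto p).comp hlim, (continuous_snd.tendsto p).comp hlim⟩

theorem isClosed_relativeTomitaGraph (M : VonNeumannAlgebra H) (Ψ Φ : H) :
    IsClosed (relativeTomitaGraph M Ψ Φ) := by
  rw [relativeTomitaGraph_eq_closure]
  exact isClosed_closure

theorem apply_mem_relativeTomitaGraph {O : H →L[ℂ] H} (hO : O ∈ M) (Ψ Φ : H) :
    (O Ψ, star O Φ) ∈ relativeTomitaGraph M Ψ Φ := by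
  rw [relativeTomitaGraph_eq_closure]
  exact subset_closure ⟨O, hO, rfl⟩

theorem relativeTomitaGraph_subset_of_isClosed {s : Set (H × H)} (hs : IsClosed s)
    (h : ∀ O ∈ M, (O Ψ, star O Φ) ∈ s) : relativeTomitaGraph M Ψ Φ ⊆ s := by
  rw [relativeTomitaGraph_eq_closure]
  refine closure_minimal ?_ hs
  rintro _ ⟨O, hO, rfl⟩
  exact h O hO

theorem mem_conjAdjointGraph_relativeTomitaGraph_iff {q : H × H} :
    q ∈ conjAdjointGraph (relativeTomitaGraph M Ψ Φ) ↔
      ∀ O ∈ M, ⟪q.1, star O Φ⟫_ℂ = (starRingEnd ℂ) ⟪q.2, O Ψ⟫_ℂ := by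
  refine ⟨fun h O hO => h _ (apply_mem_relativeTomitaGraph hO Ψ Φ), fun h p hp => ?_⟩
  exact relativeTomitaGraph_subset_of_isClosed
    (s := {p | ⟪q.1, p.2⟫_ℂ = (starRingEnd ℂ) ⟪q.2, p.1⟫_ℂ})
    (isClosed_eq (by fun_prop) (Complex.continuous_conj.comp (by fun_prop))) h hp

theorem relativeTomitaGraph_commutant_subset (M : VonNeumannAlgebra H) (Ψ Φ : H) :
    relativeTomitaGraph M.commutant Ψ Φ ⊆ conjAdjointGraph (relativeTomitaGraph M Ψ Φ) := by
  refine relativeTomitaGraph_subset_of_isClosed (isClosed_conjAdjointGraph _) fun T hT => ?_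
  rw [mem_conjAdjointGraph_relativeTomitaGraph_iff]
  intro O hO
  rw [star_inner_right, star_inner_left, inner_conj_symm, apply_comm_of_mem_commutant hO hT,
    ← star_inner_right]

/-- The closure of the graph of the operator `O Ψ ↦ O y`, `O ∈ M`. It is invariant under `M`, so the
corners of the projection onto it lie in the commutant of `M`. -/
noncomputable def orbitGraph (M : VonNeumannAlgebra H) (Ψ y : H) :
    Submodule ℂ (WithLp 2 (H × H)) :=
  Submodule.topologicalClosure
    { carrier := {p | ∃ O ∈ M, WithLp.toLp 2 (O Ψ, O y) = p}
      zero_mem' := ⟨0, zero_mem M, by simp⟩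
      add_mem' := by
        rintro _ _ ⟨O, hO, rfl⟩ ⟨O', hO', rfl⟩
        exact ⟨O + O', add_mem hO hO', by simp [← WithLp.toLp_add]⟩
      smul_mem' := by
        rintro c _ ⟨O, hO, rfl⟩
        exact ⟨c • O, M.toStarSubalgebra.smul_mem hO c, by simp [← WithLp.toLp_smul]⟩ }

instance (M : VonNeumannAlgebra H) (Ψ y : H) : CompleteSpace (orbitGraph M Ψ y) :=
  (Submodule.isClosed_topologicalClosure _).completeSpace_coe

theorem toLp_mem_orbitGraph {O : H →L[ℂ] H} (hO : O ∈ M) (Ψ y : H) :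
    WithLp.toLp 2 (O Ψ, O y) ∈ orbitGraph M Ψ y :=
  Submodule.le_topologicalClosure _ ⟨O, hO, rfl⟩

theorem orbitGraph_subset_of_isClosed {s : Set (WithLp 2 (H × H))} (hs : IsClosed s)
    (h : ∀ O ∈ M, WithLp.toLp 2 (O Ψ, O y) ∈ s) : (orbitGraph M Ψ y : Set _) ⊆ s := by
  refine closure_minimal ?_ hs
  rintro _ ⟨O, hO, rfl⟩
  exact h O hO

/-- The inclusion of the first summand into a Hilbert sum. -/
noncomputable def inlL2 (H : Type*) [NormedAddCommGroup H] [InnerProductSpace ℂ H] :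
    H →L[ℂ] WithLp 2 (H × H) :=
  (WithLp.prodContinuousLinearEquiv 2 ℂ H H).symm.toContinuousLinearMap ∘L
    ContinuousLinearMap.inl ℂ H H

/-- The upper left corner of the projection onto `orbitGraph`. -/
noncomputable def orbitGraphFst (M : VonNeumannAlgebra H) (Ψ y : H) : H →L[ℂ] H :=
  WithLp.fstL 2 ℂ H H ∘L (orbitGraph M Ψ y).starProjection ∘L inlL2 H

/-- The lower left corner of the projection onto `orbitGraph`. -/
noncomputable def orbitGraphSnd (M : VonNeumannAlgebra H) (Ψ y : H) : H →L[ℂ] H :=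
  WithLp.sndL 2 ℂ H H ∘L (orbitGraph M Ψ y).starProjection ∘L inlL2 H

section Corners

variable (M Ψ y)

theorem starProjection_orbitGraph_inl (w : H) :
    (orbitGraph M Ψ y).starProjection (WithLp.toLp 2 (w, 0)) =
      WithLp.toLp 2 (orbitGraphFst M Ψ y w, orbitGraphSnd M Ψ y w) := rfl

theorem toLp_orbitGraphFst_mem (w : H) :
    WithLp.toLp 2 (orbitGraphFst M Ψ y w, orbitGraphSnd M Ψ y w) ∈ orbitGraph M Ψ y := by
  rw [← starProjection_orbitGraph_inl]
  exact Submodule.starProjection_apply_mem _ _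

theorem inner_sub_orbitGraphFst {O : H →L[ℂ] H} (hO : O ∈ M) (w : H) :
    ⟪w - orbitGraphFst M Ψ y w, O Ψ⟫_ℂ = ⟪orbitGraphSnd M Ψ y w, O y⟫_ℂ := by
  have h := Submodule.starProjection_inner_eq_zero (K := orbitGraph M Ψ y)
    (WithLp.toLp 2 (w, 0)) _ (toLp_mem_orbitGraph hO Ψ y)
  rw [starProjection_orbitGraph_inl, ← WithLp.toLp_sub, WithLp.prod_inner_apply] at h
  simp only [Prod.mk_sub_mk, zero_sub, inner_neg_left, ← sub_eq_add_neg] at h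
  exact sub_eq_zero.mp h

variable {M Ψ y} in
theorem toLp_apply_mem_orbitGraph {O : H →L[ℂ] H} (hO : O ∈ M) {k : WithLp 2 (H × H)}
    (hk : k ∈ orbitGraph M Ψ y) : WithLp.toLp 2 (O k.fst, O k.snd) ∈ orbitGraph M Ψ y := by
  refine orbitGraph_subset_of_isClosed
    (s := {k | WithLp.toLp 2 (O k.fst, O k.snd) ∈ orbitGraph M Ψ y}) ?_ (fun A hA => ?_) hk
  · exact (Submodule.isClosed_topologicalClosure _).preimage
      ((WithLp.prod_continuous_toLp 2 H H).comp
        ((O.continuous.comp (WithLp.continuous_fst 2 H H)).prodMk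
          (O.continuous.comp (WithLp.continuous_snd 2 H H))))
  · simpa using toLp_mem_orbitGraph (mul_mem hO hA) Ψ y

theorem orbitGraphSnd_mem_commutant : orbitGraphSnd M Ψ y ∈ M.commutant := by
  rw [VonNeumannAlgebra.mem_commutant_iff]
  intro O hO
  ext w
  have hproj := Submodule.eq_starProjection_of_mem_of_inner_eq_zero (u := WithLp.toLp 2 (O w, 0))
    (toLp_apply_mem_orbitGraph hO (toLp_orbitGraphFst_mem M Ψ y w)) fun k hk => by
      refine orbitGraph_subset_of_isClosed (s := {k : WithLp 2 (H × H) | ⟪_, k⟫_ℂ = 0})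
        (isClosed_eq (by fun_prop) continuous_const) (fun A hA => ?_) hk
      have h := inner_sub_orbitGraphFst M Ψ y (mul_mem (star_mem hO) hA) w
      simp only [mul_apply_eq_comp, star_inner_right, map_sub] at h
      simp [← WithLp.toLp_sub, WithLp.prod_inner_apply, h]
  rw [starProjection_orbitGraph_inl] at hproj
  simpa using (congrArg WithLp.snd hproj).symm

theorem inner_orbitGraphFst_comm (v w : H) :
    ⟪orbitGraphFst M Ψ y v, w⟫_ℂ = ⟪v, orbitGraphFst M Ψ y w⟫_ℂ := by
  simpa [starProjection_orbitGraph_inl, WithLp.prod_inner_apply] using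
    Submodule.inner_starProjection_left_eq_right (orbitGraph M Ψ y)
      (WithLp.toLp 2 (v, 0)) (WithLp.toLp 2 (w, 0))

theorem norm_orbitGraphFst_le (w : H) : ‖orbitGraphFst M Ψ y w‖ ≤ ‖w‖ := by
  have h := pow_le_pow_left₀ (norm_nonneg _)
    (Submodule.norm_starProjection_apply_le (orbitGraph M Ψ y) (WithLp.toLp 2 (w, 0))) 2
  rw [starProjection_orbitGraph_inl, WithLp.prod_norm_sq_eq_of_L2,
    WithLp.prod_norm_sq_eq_of_L2] at h
  simp only [WithLp.toLp_fst, WithLp.toLp_snd, norm_zero, ne_eq, OfNat.ofNat_ne_zero,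
    not_false_eq_true, zero_pow, add_zero] at h
  exact (sq_le_sq₀ (norm_nonneg _) (norm_nonneg _)).mp
    ((le_add_of_nonneg_right (sq_nonneg _)).trans h)

theorem norm_sq_add_norm_sq_orbitGraph_le {O : H →L[ℂ] H} (hO : O ∈ M) :
    ‖O Ψ - orbitGraphFst M Ψ y (O Ψ)‖ ^ 2 + ‖orbitGraphSnd M Ψ y (O Ψ)‖ ^ 2 ≤ ‖O y‖ ^ 2 := by
  have hmin := (Submodule.starProjection_minimal (U := orbitGraph M Ψ y)
    (WithLp.toLp 2 (O Ψ, 0))).trans_le (ciInf_le ⟨0, by rintro _ ⟨x, rfl⟩; exact norm_nonneg _⟩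
      ⟨_, toLp_mem_orbitGraph hO Ψ y⟩)
  have hsq := pow_le_pow_left₀ (norm_nonneg _) hmin 2
  rw [starProjection_orbitGraph_inl, ← WithLp.toLp_sub, ← WithLp.toLp_sub,
    WithLp.prod_norm_sq_eq_of_L2, WithLp.prod_norm_sq_eq_of_L2] at hsq
  simpa using hsq

theorem norm_apply_sub_orbitGraphFst_le {O : H →L[ℂ] H} (hO : O ∈ M) :
    ‖O Ψ - orbitGraphFst M Ψ y (O Ψ)‖ ≤ ‖O y‖ :=
  (sq_le_sq₀ (norm_nonneg _) (norm_nonneg _)).mp ((le_add_of_nonneg_right (sq_nonneg _)).trans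
    (norm_sq_add_norm_sq_orbitGraph_le M Ψ y hO))

theorem norm_orbitGraphSnd_self_le : ‖orbitGraphSnd M Ψ y Ψ‖ ≤ ‖y‖ := by
  have h := norm_sq_add_norm_sq_orbitGraph_le M Ψ y (one_mem M)
  rw [one_apply_eq_self, one_apply_eq_self] at h
  exact (sq_le_sq₀ (norm_nonneg _) (norm_nonneg _)).mp
    ((le_add_of_nonneg_left (sq_nonneg _)).trans h)

end Corners

theorem tendsto_orbitGraphFst {ι : Type*} {l : Filter ι} {y : ι → H} (hΨ : IsCyclicVector M Ψ)
    (hy : Tendsto y l (𝓝 0)) (w : H) : Tendsto (fun i => orbitGraphFst M Ψ (y i) w) l (𝓝 w) := by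
  refine tendsto_apply_of_norm_le (S := .id ℂ H) (fun i => norm_orbitGraphFst_le M Ψ (y i)) hΨ
    ?_ w
  rintro _ ⟨O, hO, rfl⟩
  have hOy : Tendsto (fun i => ‖O (y i)‖) l (𝓝 0) := by
    simpa using ((O.continuous.tendsto 0).comp hy).norm
  refine tendsto_iff_norm_sub_tendsto_zero.mpr
    (squeeze_zero (fun _ => norm_nonneg _) (fun i => ?_) hOy)
  rw [norm_sub_rev]
  exact norm_apply_sub_orbitGraphFst_le M Ψ (y i) hO

theorem inner_apply_snd_orbitGraph (hyz : (y, z) ∈ conjAdjointGraph (relativeTomitaGraph M Ψ Φ))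
    {O : H →L[ℂ] H} (hO : O ∈ M) {k : WithLp 2 (H × H)} (hk : k ∈ orbitGraph M Ψ y) :
    ⟪O Φ, k.snd⟫_ℂ = ⟪O z, k.fst⟫_ℂ := by
  rw [mem_conjAdjointGraph_relativeTomitaGraph_iff] at hyz
  refine orbitGraph_subset_of_isClosed (s := {k | ⟪O Φ, k.snd⟫_ℂ = ⟪O z, k.fst⟫_ℂ})
    (isClosed_eq (continuous_const.inner (WithLp.continuous_snd 2 H H))
      (continuous_const.inner (WithLp.continuous_fst 2 H H))) (fun A hA => ?_) hk
  have h := congrArg (starRingEnd ℂ) (hyz (star O * A) (mul_mem (star_mem hO) hA))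
  simp only [star_mul, star_star, mul_apply_eq_comp, inner_conj_symm, star_inner_right] at h
  exact h

theorem conjAdjointGraph_real_smul {E : Type*} [NormedAddCommGroup E] [InnerProductSpace ℂ E]
    {S : Set (E × E)} {q : E × E} (hq : q ∈ conjAdjointGraph S) (e : ℝ) :
    ((e : ℂ) • q.1, (e : ℂ) • q.2) ∈ conjAdjointGraph S := fun p hp => by
  simp [hq p hp]

/-- The element `e⁻¹ • orbitGraphSnd M Ψ (e • y)` of the commutant of `M`. If `(y, z)` is in
the graph of the adjoint of `S_{Ψ|Φ}` and `y` in the closure of `M Φ`, then it maps `Ψ` close to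
`y`, and its adjoint maps `Φ` close to `z`, as `e → 0`. -/
noncomputable def tomitaApprox (M : VonNeumannAlgebra H) (Ψ y : H) (e : ℝ) : H →L[ℂ] H :=
  (e : ℂ)⁻¹ • orbitGraphSnd M Ψ ((e : ℂ) • y)

theorem norm_tomitaApprox_self_le {e : ℝ} (he : e ≠ 0) : ‖tomitaApprox M Ψ y e Ψ‖ ≤ ‖y‖ := by
  have h := norm_orbitGraphSnd_self_le M Ψ ((e : ℂ) • y)
  rw [norm_smul] at h
  rw [tomitaApprox, smul_apply, norm_smul, norm_inv, inv_mul_le_iff₀ (by simpa using he)]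
  exact h

theorem inner_tomitaApprox (hyz : (y, z) ∈ conjAdjointGraph (relativeTomitaGraph M Ψ Φ))
    {O : H →L[ℂ] H} (hO : O ∈ M) {e : ℝ} (he : e ≠ 0) (w : H) :
    ⟪O Φ, tomitaApprox M Ψ y e w⟫_ℂ = ⟪O z, orbitGraphFst M Ψ ((e : ℂ) • y) w⟫_ℂ := by
  have h := inner_apply_snd_orbitGraph (conjAdjointGraph_real_smul hyz e) hO
    (toLp_orbitGraphFst_mem M Ψ ((e : ℂ) • y) w)
  simp only [WithLp.toLp_fst, WithLp.toLp_snd, map_smul, inner_smul_left, Complex.conj_ofReal] at h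
  rw [tomitaApprox, smul_apply, inner_smul_right, h,
    inv_mul_cancel_left₀ (Complex.ofReal_ne_zero.mpr he)]

theorem star_tomitaApprox_apply (hyz : (y, z) ∈ conjAdjointGraph (relativeTomitaGraph M Ψ Φ))
    {e : ℝ} (he : e ≠ 0) :
    star (tomitaApprox M Ψ y e) Φ = orbitGraphFst M Ψ ((e : ℂ) • y) z := by
  refine ext_inner_right ℂ fun w => ?_
  rw [star_inner_left, inner_orbitGraphFst_comm]
  exact inner_tomitaApprox hyz (one_mem M) he w

theorem mem_relativeTomitaGraph_commutant_of_mem_closure (hΨ : IsCyclicVector M Ψ)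
    (hyz : (y, z) ∈ conjAdjointGraph (relativeTomitaGraph M Ψ Φ))
    (hy : y ∈ (vonNeumannOrbit M Φ).topologicalClosure) :
    (y, z) ∈ relativeTomitaGraph M.commutant Ψ Φ := by
  let e : ℕ → ℝ := fun n => 1 / ((n : ℝ) + 1)
  have he : ∀ n, e n ≠ 0 := fun n => by positivity
  have hey : Tendsto (fun n => (e n : ℂ) • y) atTop (𝓝 0) := by
    have h := (Complex.continuous_ofReal.tendsto 0).comp
      (tendsto_one_div_add_atTop_nhds_zero_nat (𝕜 := ℝ))
    simpa [e] using h.smul_const y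
  refine ⟨fun n => tomitaApprox M Ψ y (e n), fun n =>
    M.commutant.toStarSubalgebra.smul_mem (orbitGraphSnd_mem_commutant M Ψ _) _, ?_, ?_⟩
  · refine tendsto_of_tendsto_inner_of_norm_le (fun n => norm_tomitaApprox_self_le (he n)) hy ?_
    rintro _ ⟨O, hO, rfl⟩
    simp only [inner_tomitaApprox hyz hO (he _)]
    have hOy : ⟪O Φ, y⟫_ℂ = ⟪O z, Ψ⟫_ℂ :=
      inner_apply_snd_orbitGraph hyz hO (toLp_mem_orbitGraph (one_mem M) Ψ y)
    rw [hOy]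
    exact tendsto_const_nhds.inner (tendsto_orbitGraphFst hΨ hey Ψ)
  · simp only [star_tomitaApprox_apply hyz (he _)]
    exact tendsto_orbitGraphFst hΨ hey z

theorem starProjection_mem_conjAdjointGraph
    (hyz : (y, z) ∈ conjAdjointGraph (relativeTomitaGraph M Ψ Φ)) :
    ((vonNeumannOrbit M Φ).topologicalClosure.starProjection y, z) ∈
      conjAdjointGraph (relativeTomitaGraph M Ψ Φ) := by
  rw [mem_conjAdjointGraph_relativeTomitaGraph_iff] at hyz ⊢
  intro O hO
  rw [Submodule.inner_starProjection_left_eq_right, Submodule.starProjection_eq_self_iff.mpr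
    (apply_mem_closure_vonNeumannOrbit (star_mem hO) Φ)]
  exact hyz O hO

theorem mem_relativeTomitaGraph_commutant_of_starProjection_eq_zero
    (hΨ : IsCyclicVector M.commutant Ψ)
    (hy : (vonNeumannOrbit M Φ).topologicalClosure.starProjection y = 0) :
    (y, 0) ∈ relativeTomitaGraph M.commutant Ψ Φ := by
  set P := (vonNeumannOrbit M Φ).topologicalClosure.starProjection
  obtain ⟨q, hq, hlim⟩ := mem_closure_iff_seq_limit.mp (hΨ y)
  choose T hT hTq using hq
  refine ⟨fun n => (1 - P) * T n, fun n =>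
    mul_mem (sub_mem (one_mem _) (starProjection_vonNeumannOrbit_mem M Φ)) (hT n), ?_, ?_⟩
  · have hlim' : Tendsto (fun n => (1 - P) (q n)) atTop (𝓝 ((1 - P) y)) :=
      ((1 - P).continuous.tendsto y).comp hlim
    simpa [hTq, hy] using hlim'
  · have hstar : star P = P := isStarProjection_starProjection.isSelfAdjoint.star_eq
    have hPΦ : P Φ = Φ := starProjection_vonNeumannOrbit_self M Φ
    simp [star_mul, star_sub, hstar, hPΦ]

theorem conjAdjointGraph_relativeTomitaGraph (h : IsCyclicVector M Ψ)
    (h' : IsCyclicVector M.commutant Ψ) :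
    conjAdjointGraph (relativeTomitaGraph M Ψ Φ) = relativeTomitaGraph M.commutant Ψ Φ := by
  refine Set.Subset.antisymm ?_ (relativeTomitaGraph_commutant_subset M Ψ Φ)
  rintro ⟨y, z⟩ hyz
  set P := (vonNeumannOrbit M Φ).topologicalClosure.starProjection
  have hPy : P y ∈ (vonNeumannOrbit M Φ).topologicalClosure :=
    Submodule.starProjection_apply_mem _ y
  have hclosure : (P y, z) ∈ relativeTomitaGraph M.commutant Ψ Φ :=
    mem_relativeTomitaGraph_commutant_of_mem_closure h (starProjection_mem_conjAdjointGraph hyz) hPy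
  have horthogonal : (y - P y, 0) ∈ relativeTomitaGraph M.commutant Ψ Φ :=
    mem_relativeTomitaGraph_commutant_of_starProjection_eq_zero h'
      (by rw [map_sub, Submodule.starProjection_eq_self_iff.mpr hPy, sub_self])
  simpa using relativeTomitaGraph_add horthogonal hclosure

end TomitaAdjoint

/-! ### The relative modular operator -/

section ModularOperator

variable {H : Type*} [NormedAddCommGroup H] [InnerProductSpace ℂ H] [CompleteSpace H]
  {M : VonNeumannAlgebra H} {Ψ Φ : H}

theorem eq_zero_of_mem_relativeTomitaGraph (h' : IsCyclicVector M.commutant Ψ) {y : H}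
    (hy : (0, y) ∈ relativeTomitaGraph M Ψ Φ) : y = 0 := by
  refine h'.eq_zero_of_inner_right ℂ ?_
  rintro _ ⟨T, hT, rfl⟩
  simpa using relativeTomitaGraph_commutant_subset M Ψ Φ (apply_mem_relativeTomitaGraph hT Ψ Φ) _ hy

theorem eq_zero_of_mem_conjAdjointGraph (h : IsCyclicVector M Ψ) {z : H}
    (hz : (0, z) ∈ conjAdjointGraph (relativeTomitaGraph M Ψ Φ)) : z = 0 := by
  refine h.eq_zero_of_inner_right ℂ ?_
  rintro _ ⟨O, hO, rfl⟩
  simpa [eq_comm] using hz _ (apply_mem_relativeTomitaGraph hO Ψ Φ)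

theorem graph_relativeModularOperator (h : IsCyclicVector M Ψ)
    (h' : IsCyclicVector M.commutant Ψ) :
    (relativeModularOperator M Ψ Φ).graph = relativeModularGraph M Ψ Φ := by
  refine Submodule.toLinearPMap_graph_eq _ ?_
  rintro ⟨_, z⟩ ⟨y, hy, hz⟩ rfl
  obtain rfl := eq_zero_of_mem_relativeTomitaGraph h' hy
  exact eq_zero_of_mem_conjAdjointGraph h hz

theorem exists_inner_eq_of_mem_relativeModularGraph {p : H × H}
    (hp : p ∈ relativeModularGraph M Ψ Φ) : ∃ r : ℝ, 0 ≤ r ∧ ⟪p.1, p.2⟫_ℂ = r := by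
  obtain ⟨y, hy, hz⟩ := hp
  have h := hz _ hy
  rw [inner_conj_symm, inner_self_eq_norm_sq_to_K] at h
  exact ⟨‖y‖ ^ 2, by positivity, by rw [← h]; norm_cast⟩

-- The pair is the orthogonal projection of `(w, 0)` onto the graph, which is a real subspace only.
theorem exists_mem_relativeTomitaGraph_re_inner_eq (M : VonNeumannAlgebra H) (Ψ Φ w : H) :
    ∃ p ∈ relativeTomitaGraph M Ψ Φ, ∀ q ∈ relativeTomitaGraph M Ψ Φ,
      (⟪w - p.1, q.1⟫_ℂ).re = (⟪p.2, q.2⟫_ℂ).re := by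
  let _ : InnerProductSpace ℝ H := InnerProductSpace.complexToReal
  let G : Submodule ℝ (WithLp 2 (H × H)) :=
    { carrier := {p | (p.fst, p.snd) ∈ relativeTomitaGraph M Ψ Φ}
      zero_mem' := relativeTomitaGraph_zero M Ψ Φ
      add_mem' := relativeTomitaGraph_add
      smul_mem' := fun c p hp => by simpa using relativeTomitaGraph_smul (c : ℂ) hp }
  have hG : IsClosed (G : Set (WithLp 2 (H × H))) :=
    (isClosed_relativeTomitaGraph M Ψ Φ).preimage
      ((WithLp.continuous_fst 2 H H).prodMk (WithLp.continuous_snd 2 H H))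
  have : CompleteSpace G := hG.completeSpace_coe
  refine ⟨_, G.starProjection_apply_mem (WithLp.toLp 2 (w, 0)), fun q hq => ?_⟩
  have horth := G.starProjection_inner_eq_zero (WithLp.toLp 2 (w, 0)) (WithLp.toLp 2 q) hq
  rw [WithLp.prod_inner_apply] at horth
  simp only [WithLp.ofLp_sub, Prod.fst_sub, Prod.snd_sub, zero_sub, inner_neg_left] at horth
  exact add_neg_eq_zero.mp horth

theorem exists_mem_relativeModularGraph_add_eq (M : VonNeumannAlgebra H) (Ψ Φ w : H) :
    ∃ p ∈ relativeModularGraph M Ψ Φ, p.1 + p.2 = w := by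
  obtain ⟨p, hp, hre⟩ := exists_mem_relativeTomitaGraph_re_inner_eq M Ψ Φ w
  refine ⟨(p.1, w - p.1), ⟨p.2, hp, fun q hq => Complex.ext ?_ ?_⟩, by simp⟩
  · rw [Complex.conj_re]
    exact (hre q hq).symm
  · have him := hre _ (relativeTomitaGraph_smul Complex.I hq)
    simp only [inner_smul_right, Complex.conj_I, Complex.mul_re, Complex.I_re, Complex.I_im,
      Complex.neg_re, Complex.neg_im] at him
    rw [Complex.conj_im]
    linarith

end ModularOperator

/-! ### Reconstruction -/

section Reconstruction

variable {H K : Type*} [NormedAddCommGroup H] [InnerProductSpace ℂ H] [CompleteSpace H]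
  [NormedAddCommGroup K] [InnerProductSpace ℂ K] [CompleteSpace K] {u : H →L[ℂ] K}
  {M : VonNeumannAlgebra H} {N : VonNeumannAlgebra K} {Ψ Φ : H}

/-- The operators of `M` can be reconstructed in `N` through `u`: each `O ∈ M` has a representative
`T ∈ N` with `u O = T u` and `u O† = T† u`. -/
def Reconstructs (u : H →L[ℂ] K) (M : VonNeumannAlgebra H) (N : VonNeumannAlgebra K) : Prop :=
  ∀ O ∈ M, ∃ T ∈ N, ∀ x, u (O x) = T (u x) ∧ u (star O x) = star T (u x)

theorem Reconstructs.map_mem_relativeTomitaGraph (hu : Reconstructs u M N) {p : H × H}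
    (hp : p ∈ relativeTomitaGraph M Ψ Φ) :
    (u p.1, u p.2) ∈ relativeTomitaGraph N (u Ψ) (u Φ) := by
  obtain ⟨O, hO, hfst, hsnd⟩ := hp
  choose T hT hTu using fun n => hu (O n) (hO n)
  refine ⟨T, hT, ?_, ?_⟩
  · simpa only [Function.comp_def, (hTu _ _).1] using (u.continuous.tendsto _).comp hfst
  · simpa only [Function.comp_def, (hTu _ _).2] using (u.continuous.tendsto _).comp hsnd

theorem Reconstructs.map_mem_relativeModularGraph (hu : Reconstructs u M N)
    (hu' : Reconstructs u M.commutant N.commutant) (h : IsCyclicVector M Ψ)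
    (h' : IsCyclicVector M.commutant Ψ) {p : H × H} (hp : p ∈ relativeModularGraph M Ψ Φ) :
    (u p.1, u p.2) ∈ relativeModularGraph N (u Ψ) (u Φ) := by
  obtain ⟨y, hy, hz⟩ := hp
  refine ⟨u y, hu.map_mem_relativeTomitaGraph hy, ?_⟩
  rw [conjAdjointGraph_relativeTomitaGraph h h'] at hz
  exact relativeTomitaGraph_commutant_subset _ _ _ (hu'.map_mem_relativeTomitaGraph hz)

theorem Reconstructs.isSeparatingVector_map (hu' : Reconstructs u M.commutant N.commutant) {Ω : H}
    (hΩ : IsSeparatingVector N (u Ω)) (h : IsCyclicVector M.commutant Ψ) :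
    IsSeparatingVector N (u Ψ) := by
  intro T hT hTΨ
  have hTu : ⇑(T ∘L u) = ⇑(0 : H →L[ℂ] K) := by
    refine Continuous.ext_on h (T ∘L u).continuous continuous_const ?_
    rintro _ ⟨O, hO, rfl⟩
    obtain ⟨S, hS, hSu⟩ := hu' O hO
    simp [(hSu Ψ).1, apply_comm_of_mem_commutant hT hS, hTΨ]
  exact hΩ T hT (congrFun hTu Ω)

end Reconstruction

/-! ### Projection valued measures and their scalar measures -/

section ProjectionValuedMeasure

open Filter Topology MeasureTheory

namespace ProjectionValuedMeasure

variable {H : Type*} [NormedAddCommGroup H] [InnerProductSpace ℂ H] [CompleteSpace H]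
  (P : ProjectionValuedMeasure H)

theorem ext_of_measurableSet {P Q : ProjectionValuedMeasure H}
    (h : ∀ s, MeasurableSet s → P.proj s = Q.proj s) : P = Q := by
  have hproj : P.proj = Q.proj := by
    funext s
    by_cases hs : MeasurableSet s
    · exact h s hs
    · rw [P.not_measurable' s hs, Q.not_measurable' s hs]
  cases P
  cases Q
  congr

theorem proj_proj {s t : Set ℝ} (hs : MeasurableSet s) (ht : MeasurableSet t) (x : H) :
    P.proj s (P.proj t x) = P.proj (s ∩ t) x :=
  congrArg (fun T : H →L[ℂ] H => T x) (P.inter' s t hs ht)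

theorem proj_proj_self {s : Set ℝ} (hs : MeasurableSet s) (x : H) :
    P.proj s (P.proj s x) = P.proj s x := by
  rw [P.proj_proj hs hs, Set.inter_self]

theorem inner_proj_left {s : Set ℝ} (hs : MeasurableSet s) (x y : H) :
    ⟪P.proj s x, y⟫_ℂ = ⟪x, P.proj s y⟫_ℂ := by
  conv_lhs => rw [← (P.isStarProjection' s hs).isSelfAdjoint.star_eq]
  exact star_inner_left _ _ _

theorem inner_proj_self {s : Set ℝ} (hs : MeasurableSet s) (x : H) :
    ⟪x, P.proj s x⟫_ℂ = ((‖P.proj s x‖ ^ 2 : ℝ) : ℂ) := by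
  rw [← P.proj_proj_self hs, ← P.inner_proj_left hs, inner_self_eq_norm_sq_to_K,
    P.proj_proj_self hs]
  norm_cast

theorem scalarMeasure_apply {s : Set ℝ} (hs : MeasurableSet s) (x : H) :
    P.scalarMeasure x s = ENNReal.ofReal (‖P.proj s x‖ ^ 2) := by
  rw [scalarMeasure, Measure.ofMeasurable_apply _ hs, P.inner_proj_self hs, Complex.ofReal_re]

theorem scalarMeasure_univ (x : H) : P.scalarMeasure x Set.univ = ENNReal.ofReal (‖x‖ ^ 2) := by
  rw [P.scalarMeasure_apply .univ, P.univ', one_apply_eq_self]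

instance (x : H) : IsFiniteMeasure (P.scalarMeasure x) :=
  ⟨by rw [P.scalarMeasure_univ]; exact ENNReal.ofReal_lt_top⟩

theorem scalarMeasure_proj {s : Set ℝ} (hs : MeasurableSet s) (x : H) :
    P.scalarMeasure (P.proj s x) = (P.scalarMeasure x).restrict s := by
  ext t ht
  rw [Measure.restrict_apply ht, P.scalarMeasure_apply ht, P.scalarMeasure_apply (ht.inter hs),
    P.proj_proj ht hs]

theorem scalarMeasure_add {s : Set ℝ} (hs : MeasurableSet s) {x y : H} (hx : P.proj s x = x)
    (hy : P.proj s y = 0) : P.scalarMeasure (x + y) = P.scalarMeasure x + P.scalarMeasure y := by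
  ext t ht
  rw [Measure.add_apply, P.scalarMeasure_apply ht, P.scalarMeasure_apply ht,
    P.scalarMeasure_apply ht, ← ENNReal.ofReal_add (by positivity) (by positivity), map_add]
  congr 1
  have horth : ⟪P.proj t x, P.proj t y⟫_ℂ = 0 := by
    rw [P.inner_proj_left ht, P.proj_proj_self ht, ← hx, P.inner_proj_left hs, P.proj_proj hs ht,
      Set.inter_comm, ← P.proj_proj ht hs, hy, map_zero, inner_zero_right]
  simpa [horth] using norm_add_sq (𝕜 := ℂ) (P.proj t x) (P.proj t y)

theorem scalarMeasure_real {s : Set ℝ} (hs : MeasurableSet s) (x : H) :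
    (P.scalarMeasure x).real s = ‖P.proj s x‖ ^ 2 := by
  rw [Measure.real, P.scalarMeasure_apply hs, ENNReal.toReal_ofReal (by positivity)]

theorem norm_proj_apply_le {s : Set ℝ} (hs : MeasurableSet s) (x : H) : ‖P.proj s x‖ ≤ ‖x‖ := by
  simpa using (P.proj s).le_of_opNorm_le ((P.isStarProjection' s hs).norm_le _) x

theorem proj_union {s t : Set ℝ} (hs : MeasurableSet s) (ht : MeasurableSet t)
    (hd : Disjoint s t) (x : H) : P.proj (s ∪ t) x = P.proj s x + P.proj t x := by
  have hadd : (P.proj (s ∪ t) : H →ₗ[ℂ] H) = (P.proj s + P.proj t : H →L[ℂ] H) := by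
    rw [← ext_inner_map]
    intro x
    have h := measureReal_union (μ := P.scalarMeasure x) hd ht
    rw [P.scalarMeasure_real hs, P.scalarMeasure_real ht, P.scalarMeasure_real (hs.union ht)] at h
    simp only [ContinuousLinearMap.coe_coe, add_apply, inner_add_left, P.inner_proj_left hs,
      P.inner_proj_left ht, P.inner_proj_left (hs.union ht), P.inner_proj_self hs,
      P.inner_proj_self ht, P.inner_proj_self (hs.union ht), h]
    push_cast
    rfl
  exact congrArg (fun T : H →ₗ[ℂ] H => T x) hadd

theorem proj_compl {s : Set ℝ} (hs : MeasurableSet s) (x : H) :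
    P.proj sᶜ x = x - P.proj s x := by
  have h := P.proj_union hs hs.compl disjoint_compl_right x
  rw [Set.union_compl_self, P.univ', one_apply_eq_self] at h
  rw [eq_sub_iff_add_eq', ← h]

theorem proj_diff {s t : Set ℝ} (hs : MeasurableSet s) (ht : MeasurableSet t) (hst : s ⊆ t)
    (x : H) : P.proj (t \ s) x = P.proj t x - P.proj s x := by
  have h := P.proj_union hs (ht.diff hs) Set.disjoint_sdiff_right x
  rw [Set.union_sdiff_cancel hst] at h
  rw [eq_sub_iff_add_eq', ← h]

theorem tendsto_proj_iUnion {s : ℕ → Set ℝ} (hs : ∀ n, MeasurableSet (s n)) (hm : Monotone s)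
    (x : H) : Tendsto (fun n => P.proj (s n) x) atTop (𝓝 (P.proj (⋃ n, s n) x)) := by
  have hreal : Tendsto (fun n => (P.scalarMeasure x).real (s n)) atTop
      (𝓝 ((P.scalarMeasure x).real (⋃ n, s n))) :=
    (ENNReal.tendsto_toReal (measure_ne_top _ _)).comp (tendsto_measure_iUnion_atTop hm)
  have hnorm : ∀ n, ‖P.proj (s n) x - P.proj (⋃ n, s n) x‖ ^ 2 =
      (P.scalarMeasure x).real (⋃ n, s n) - (P.scalarMeasure x).real (s n) := fun n => by
    have hsub : s n ⊆ ⋃ n, s n := Set.subset_iUnion s n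
    rw [← measureReal_sdiff hsub (hs n),
      P.scalarMeasure_real ((MeasurableSet.iUnion hs).diff (hs n)),
      P.proj_diff (hs n) (MeasurableSet.iUnion hs) hsub, norm_sub_rev]
  have hsq : Tendsto (fun n => ‖P.proj (s n) x - P.proj (⋃ n, s n) x‖ ^ 2) atTop (𝓝 0) := by
    simp only [hnorm]
    simpa using hreal.const_sub ((P.scalarMeasure x).real (⋃ n, s n))
  rw [tendsto_iff_norm_sub_tendsto_zero]
  simpa [Function.comp_def] using (Real.continuous_sqrt.tendsto 0).comp hsq

theorem tendsto_proj_Icc (x : H) :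
    Tendsto (fun n : ℕ => P.proj (Set.Icc (-(n : ℝ)) n) x) atTop (𝓝 x) := by
  have hm : Monotone fun n : ℕ => Set.Icc (-(n : ℝ)) n := fun m n hmn =>
    Set.Icc_subset_Icc (by simpa using hmn) (by simpa using hmn)
  have h := P.tendsto_proj_iUnion (fun n => measurableSet_Icc) hm x
  have hU : (⋃ n : ℕ, Set.Icc (-(n : ℝ)) n) = Set.univ := by
    refine Set.eq_univ_of_forall fun t => ?_
    obtain ⟨n, hn⟩ := exists_nat_ge |t|
    exact Set.mem_iUnion.mpr ⟨n, abs_le.mp hn⟩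
  rwa [hU, P.univ', one_apply_eq_self] at h

theorem tendsto_proj_Iic (c : ℝ) (x : H) :
    Tendsto (fun n : ℕ => P.proj (Set.Icc (c - 1 - n) c) x) atTop (𝓝 (P.proj (Set.Iic c) x)) := by
  have hm : Monotone fun n : ℕ => Set.Icc (c - 1 - n) c := fun m n hmn =>
    Set.Icc_subset_Icc (by gcongr) le_rfl
  have h := P.tendsto_proj_iUnion (fun n => measurableSet_Icc) hm x
  have hU : (⋃ n : ℕ, Set.Icc (c - 1 - n) c) = Set.Iic c := by
    ext t
    simp only [Set.mem_iUnion, Set.mem_Icc, Set.mem_Iic]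
    refine ⟨fun ⟨n, hn⟩ => hn.2, fun ht => ?_⟩
    obtain ⟨n, hn⟩ := exists_nat_ge (c - 1 - t)
    exact ⟨n, by linarith, ht⟩
  rwa [hU] at h

theorem tendsto_proj_Ioi (c : ℝ) (x : H) :
    Tendsto (fun n : ℕ => P.proj (Set.Icc (c + 1 / ((n : ℝ) + 1)) (c + 2 + n)) x) atTop
      (𝓝 (P.proj (Set.Ioi c) x)) := by
  have hm : Monotone fun n : ℕ => Set.Icc (c + 1 / ((n : ℝ) + 1)) (c + 2 + n) := fun m n hmn =>
    Set.Icc_subset_Icc (by gcongr) (by gcongr)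
  have h := P.tendsto_proj_iUnion (fun n => measurableSet_Icc) hm x
  have hU : (⋃ n : ℕ, Set.Icc (c + 1 / ((n : ℝ) + 1)) (c + 2 + n)) = Set.Ioi c := by
    ext t
    simp only [Set.mem_iUnion, Set.mem_Icc, Set.mem_Ioi]
    refine ⟨fun ⟨n, hn⟩ => lt_of_lt_of_le ?_ hn.1, fun ht => ?_⟩
    · have : 0 < 1 / ((n : ℝ) + 1) := by positivity
      linarith
    · obtain ⟨n, hn⟩ := exists_nat_one_div_lt (sub_pos.mpr ht)
      obtain ⟨k, hk⟩ := exists_nat_ge (t - c - 2)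
      refine ⟨max n k, ?_, ?_⟩
      · have : 1 / (((max n k : ℕ) : ℝ) + 1) ≤ 1 / ((n : ℝ) + 1) := by
          gcongr
          exact le_max_left _ _
        linarith
      · have : (k : ℝ) ≤ (max n k : ℕ) := by exact_mod_cast le_max_right _ _
        linarith
  rwa [hU] at h

end ProjectionValuedMeasure

end ProjectionValuedMeasure

/-! ### Numerical bounds for symmetric graphs -/

section SymmetricGraph

variable {E : Type*} [NormedAddCommGroup E] [InnerProductSpace ℂ E] {G : Submodule ℂ (E × E)}

theorem inner_fst_snd_eq_of_im_eq_zero (hG : ∀ p ∈ G, (⟪p.1, p.2⟫_ℂ).im = 0)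
    {p q : E × E} (hp : p ∈ G) (hq : q ∈ G) : ⟪p.1, q.2⟫_ℂ = ⟪p.2, q.1⟫_ℂ := by
  have hadd := hG _ (add_mem hp hq)
  have haddI := hG _ (add_mem hp (G.smul_mem Complex.I hq))
  simp only [Prod.fst_add, Prod.snd_add, Prod.smul_fst, Prod.smul_snd, inner_add_left,
    inner_add_right, inner_smul_left, inner_smul_right, Complex.add_im, Complex.mul_im,
    Complex.add_re, Complex.mul_re, Complex.I_re, Complex.I_im, Complex.conj_I, Complex.neg_re,
    Complex.neg_im, hG _ hp, hG _ hq] at hadd haddI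
  rw [← inner_conj_symm p.2 q.1]
  refine Complex.ext ?_ ?_
  · rw [Complex.conj_re]
    linarith
  · rw [Complex.conj_im]
    linarith

/-- The pairing of `p = (x, y)` with `q = (y - m x, z - m y)` is read off from the quadratic
form at `h p ± q`. -/
theorem norm_sub_smul_le_of_abs_re_inner_sub_le {m h : ℝ} (hh : 0 < h)
    (him : ∀ p ∈ G, (⟪p.1, p.2⟫_ℂ).im = 0)
    (hG : ∀ p ∈ G, |(⟪p.1, p.2⟫_ℂ).re - m * ‖p.1‖ ^ 2| ≤ h * ‖p.1‖ ^ 2) {x y z : E}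
    (hxy : (x, y) ∈ G) (hyz : (y, z) ∈ G) : ‖y - (m : ℂ) • x‖ ≤ h * ‖x‖ := by
  have hq : (y - (m : ℂ) • x, z - (m : ℂ) • y) ∈ G := sub_mem hyz (G.smul_mem (m : ℂ) hxy)
  have hadd := (abs_le.mp (hG _ (add_mem (G.smul_mem (h : ℂ) hxy) hq))).2
  have hsub := (abs_le.mp (hG _ (sub_mem (G.smul_mem (h : ℂ) hxy) hq))).1
  have hsymm : ⟪x, z⟫_ℂ = ⟪y, y⟫_ℂ := inner_fst_snd_eq_of_im_eq_zero him hxy hyz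
  have hself : ∀ v : E, ‖v‖ ^ 2 = (⟪v, v⟫_ℂ).re := fun v => (inner_self_eq_norm_sq (𝕜 := ℂ) v).symm
  have hcomm : (⟪y, x⟫_ℂ).re = (⟪x, y⟫_ℂ).re := inner_re_symm (𝕜 := ℂ) y x
  refine abs_le_of_sq_le_sq' ?_ (by positivity) |>.2
  rw [mul_pow, hself, hself]
  simp only [Prod.fst_add, Prod.snd_add, Prod.fst_sub, Prod.snd_sub, Prod.smul_fst, Prod.smul_snd,
    hself, inner_add_left, inner_add_right, inner_sub_left, inner_sub_right, inner_smul_left,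
    inner_smul_right, Complex.conj_ofReal, Complex.add_re, Complex.sub_re, Complex.re_ofReal_mul,
    hcomm, hsymm] at hadd hsub ⊢
  refine le_of_mul_le_mul_left ?_ hh
  linarith

end SymmetricGraph

/-! ### Operators with a spectral measure -/

section SpectralMeasure

open Filter Topology MeasureTheory

namespace ProjectionValuedMeasure.IsSpectralMeasureOf

variable {H K : Type*} [NormedAddCommGroup H] [InnerProductSpace ℂ H] [CompleteSpace H]
  [NormedAddCommGroup K] [InnerProductSpace ℂ K] [CompleteSpace K]
  {P : ProjectionValuedMeasure H} {A : H →ₗ.[ℂ] H}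
  {Q : ProjectionValuedMeasure K} {B : K →ₗ.[ℂ] K}

theorem inner_eq_integral (hA : P.IsSpectralMeasureOf A) {p : H × H} (hp : p ∈ A.graph) :
    ⟪p.1, p.2⟫_ℂ = ((∫ t, t ∂(P.scalarMeasure p.1) : ℝ) : ℂ) := by
  obtain ⟨x, hx, hy⟩ := A.mem_graph_iff.mp hp
  rw [← hx, ← hy]
  exact hA.2 x

theorem im_inner_eq_zero (hA : P.IsSpectralMeasureOf A) {p : H × H} (hp : p ∈ A.graph) :
    (⟪p.1, p.2⟫_ℂ).im = 0 := by
  rw [hA.inner_eq_integral hp, Complex.ofReal_im]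

theorem lintegral_lt_top (hA : P.IsSpectralMeasureOf A) {p : H × H} (hp : p ∈ A.graph) :
    ∫⁻ t, ENNReal.ofReal (t ^ 2) ∂(P.scalarMeasure p.1) < ∞ := by
  obtain ⟨x, hx, -⟩ := A.mem_graph_iff.mp hp
  rw [← hx]
  exact (hA.1 x).mp x.2

theorem exists_mem_graph (hA : P.IsSpectralMeasureOf A) {x : H}
    (hx : ∫⁻ t, ENNReal.ofReal (t ^ 2) ∂(P.scalarMeasure x) < ∞) : ∃ y, (x, y) ∈ A.graph :=
  ⟨A ⟨x, (hA.1 x).mpr hx⟩, A.mem_graph ⟨x, (hA.1 x).mpr hx⟩⟩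

theorem integrable (hA : P.IsSpectralMeasureOf A) {p : H × H} (hp : p ∈ A.graph) :
    Integrable (fun t : ℝ => t) (P.scalarMeasure p.1) := by
  refine ⟨measurable_id.aestronglyMeasurable, ?_⟩
  calc ∫⁻ t, ‖t‖ₑ ∂(P.scalarMeasure p.1)
      ≤ ∫⁻ t, (1 + ENNReal.ofReal (t ^ 2)) ∂(P.scalarMeasure p.1) := by
        refine lintegral_mono fun t => ?_
        simp only
        rw [← ofReal_norm, ← ENNReal.ofReal_one,
          ← ENNReal.ofReal_add zero_le_one (by positivity)]
        refine ENNReal.ofReal_le_ofReal ?_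
        rw [Real.norm_eq_abs, ← sq_abs]
        nlinarith [sq_nonneg (|t| - 1)]
    _ < ∞ := by
        rw [lintegral_add_left measurable_const, lintegral_const, one_mul]
        exact ENNReal.add_lt_top.mpr ⟨measure_lt_top _ _, hA.lintegral_lt_top hp⟩

theorem exists_mem_graph_proj (hA : P.IsSpectralMeasureOf A) {p : H × H} (hp : p ∈ A.graph)
    {s : Set ℝ} (hs : MeasurableSet s) : ∃ y, (P.proj s p.1, y) ∈ A.graph := by
  refine hA.exists_mem_graph ?_
  rw [P.scalarMeasure_proj hs]
  exact (lintegral_mono' Measure.restrict_le_self le_rfl).trans_lt (hA.lintegral_lt_top hp)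

theorem exists_mem_graph_proj_Icc (hA : P.IsSpectralMeasureOf A) {a b : ℝ} (x : H) :
    ∃ y, (P.proj (Set.Icc a b) x, y) ∈ A.graph := by
  refine hA.exists_mem_graph ?_
  rw [P.scalarMeasure_proj measurableSet_Icc]
  calc ∫⁻ t in Set.Icc a b, ENNReal.ofReal (t ^ 2) ∂(P.scalarMeasure x)
      ≤ ∫⁻ _ in Set.Icc a b, ENNReal.ofReal (a ^ 2 + b ^ 2) ∂(P.scalarMeasure x) := by
        refine setLIntegral_mono measurable_const fun t ht => ENNReal.ofReal_le_ofReal ?_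
        rcases le_total 0 t with h | h
        · nlinarith [ht.1, ht.2, sq_nonneg a]
        · nlinarith [ht.1, ht.2, sq_nonneg b]
    _ < ∞ := by
        rw [lintegral_const]
        exact ENNReal.mul_lt_top ENNReal.ofReal_lt_top (measure_lt_top _ _)

theorem dense_domain (hA : P.IsSpectralMeasureOf A) : Dense {x : H | ∃ y, (x, y) ∈ A.graph} :=
  fun x => mem_closure_of_tendsto (P.tendsto_proj_Icc x)
    (Eventually.of_forall fun _ => hA.exists_mem_graph_proj_Icc x)

theorem inner_add_inner_eq_zero (hA : P.IsSpectralMeasureOf A) {p q : H × H} (hp : p ∈ A.graph)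
    (hq : q ∈ A.graph) {s : Set ℝ} (hs : MeasurableSet s) (hps : P.proj s p.1 = p.1)
    (hqs : P.proj s q.1 = 0) : ⟪p.1, q.2⟫_ℂ + ⟪q.1, p.2⟫_ℂ = 0 := by
  have hadd := hA.inner_eq_integral (add_mem hp hq)
  rw [Prod.fst_add, P.scalarMeasure_add hs hps hqs,
    integral_add_measure (hA.integrable hp) (hA.integrable hq), Complex.ofReal_add,
    ← hA.inner_eq_integral hp, ← hA.inner_eq_integral hq, Prod.snd_add, inner_add_left,
    inner_add_right, inner_add_right] at hadd
  linear_combination hadd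

theorem inner_eq_zero (hA : P.IsSpectralMeasureOf A) {p q : H × H} (hp : p ∈ A.graph)
    (hq : q ∈ A.graph) {s : Set ℝ} (hs : MeasurableSet s) (hps : P.proj s p.1 = p.1)
    (hqs : P.proj s q.1 = 0) : ⟪q.1, p.2⟫_ℂ = 0 := by
  have hsum := hA.inner_add_inner_eq_zero hp hq hs hps hqs
  have hsumI := hA.inner_add_inner_eq_zero hp (A.graph.smul_mem Complex.I hq) hs hps (by simp [hqs])
  simp only [Prod.smul_fst, Prod.smul_snd, inner_smul_left, inner_smul_right,
    Complex.conj_I] at hsumI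
  have htwo : Complex.I * (2 * ⟪q.1, p.2⟫_ℂ) = 0 := by
    linear_combination Complex.I * hsum - hsumI
  simpa using htwo

theorem proj_snd_eq_self (hA : P.IsSpectralMeasureOf A) {p : H × H} (hp : p ∈ A.graph)
    {s : Set ℝ} (hs : MeasurableSet s) (hps : P.proj s p.1 = p.1) : P.proj s p.2 = p.2 := by
  refine (sub_eq_zero.mp (hA.dense_domain.eq_zero_of_inner_right ℂ ?_)).symm
  rintro v ⟨w, hw⟩
  obtain ⟨z, hz⟩ := hA.exists_mem_graph_proj hw hs.compl
  rw [← P.proj_compl hs, ← P.inner_proj_left hs.compl]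
  refine hA.inner_eq_zero hp hz hs hps ?_
  rw [P.proj_proj hs hs.compl, Set.inter_compl_self, P.empty', zero_apply]

theorem proj_mem_graph (hA : P.IsSpectralMeasureOf A) {p : H × H} (hp : p ∈ A.graph)
    {s : Set ℝ} (hs : MeasurableSet s) : (P.proj s p.1, P.proj s p.2) ∈ A.graph := by
  obtain ⟨y, hy⟩ := hA.exists_mem_graph_proj hp hs
  have hcompl : (P.proj sᶜ p.1, p.2 - y) ∈ A.graph := by
    rw [P.proj_compl hs]
    exact sub_mem hp hy
  have hys : P.proj s y = y := hA.proj_snd_eq_self hy hs (P.proj_proj_self hs _)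
  have hys' : P.proj sᶜ (p.2 - y) = p.2 - y :=
    hA.proj_snd_eq_self hcompl hs.compl (P.proj_proj_self hs.compl _)
  rw [P.proj_compl hs, sub_eq_self, map_sub, hys, sub_eq_zero] at hys'
  rwa [hys']

theorem re_inner_mem_Icc (hA : P.IsSpectralMeasureOf A) {p : H × H} (hp : p ∈ A.graph) {a b : ℝ}
    (hps : P.proj (Set.Icc a b) p.1 = p.1) :
    (⟪p.1, p.2⟫_ℂ).re ∈ Set.Icc (a * ‖p.1‖ ^ 2) (b * ‖p.1‖ ^ 2) := by
  have hconst (c : ℝ) : ∫ _, c ∂(P.scalarMeasure p.1) = c * ‖p.1‖ ^ 2 := by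
    rw [integral_const, P.scalarMeasure_real .univ, P.univ', one_apply_eq_self, smul_eq_mul,
      mul_comm]
  have hmem : ∀ᵐ t ∂(P.scalarMeasure p.1), t ∈ Set.Icc a b := by
    rw [← hps, P.scalarMeasure_proj measurableSet_Icc]
    exact ae_restrict_mem measurableSet_Icc
  rw [hA.inner_eq_integral hp, Complex.ofReal_re, ← hconst, ← hconst]
  exact ⟨integral_mono_ae (integrable_const a) (hA.integrable hp) (hmem.mono fun _ ht => ht.1),
    integral_mono_ae (hA.integrable hp) (integrable_const b) (hmem.mono fun _ ht => ht.2)⟩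

theorem norm_sub_midpoint_smul_le (hA : P.IsSpectralMeasureOf A) {p : H × H} (hp : p ∈ A.graph)
    {a b : ℝ} (hab : a < b) (hps : P.proj (Set.Icc a b) p.1 = p.1) :
    ‖p.2 - (((a + b) / 2 : ℝ) : ℂ) • p.1‖ ≤ (b - a) / 2 * ‖p.1‖ := by
  let G : Submodule ℂ (H × H) := A.graph ⊓
    LinearMap.eqLocus ((P.proj (Set.Icc a b)).toLinearMap ∘ₗ LinearMap.fst ℂ H H)
      (LinearMap.fst ℂ H H)
  have hp2 : P.proj (Set.Icc a b) p.2 = p.2 := hA.proj_snd_eq_self hp measurableSet_Icc hps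
  obtain ⟨z, hz⟩ := hA.exists_mem_graph_proj_Icc (a := a) (b := b) p.2
  rw [hp2] at hz
  refine norm_sub_smul_le_of_abs_re_inner_sub_le (G := G) (by linarith)
    (fun q hq => hA.im_inner_eq_zero hq.1) (fun q hq => ?_) (y := p.2) ⟨hp, hps⟩ ⟨hz, hp2⟩
  obtain ⟨hle, hge⟩ := hA.re_inner_mem_Icc hq.1 hq.2
  rw [abs_le]
  constructor <;> linarith

theorem mul_norm_le_norm_sub_smul (hA : P.IsSpectralMeasureOf A) {p : H × H} (hp : p ∈ A.graph)
    {a b : ℝ} (m : ℝ) (hps : P.proj (Set.Icc a b) p.1 = p.1) :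
    max (a - m) (m - b) * ‖p.1‖ ≤ ‖p.2 - (m : ℂ) • p.1‖ := by
  rcases (norm_nonneg p.1).eq_or_lt with hzero | hpos
  · rw [← hzero, mul_zero]
    exact norm_nonneg _
  obtain ⟨hle, hge⟩ := hA.re_inner_mem_Icc hp hps
  have hself : (⟪p.1, p.1⟫_ℂ).re = ‖p.1‖ ^ 2 := inner_self_eq_norm_sq (𝕜 := ℂ) p.1
  have hcs : |(⟪p.1, p.2 - (m : ℂ) • p.1⟫_ℂ).re| ≤ ‖p.1‖ * ‖p.2 - (m : ℂ) • p.1‖ :=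
    (Complex.abs_re_le_norm _).trans (norm_inner_le_norm _ _)
  rw [inner_sub_right, inner_smul_right, Complex.sub_re, Complex.re_ofReal_mul, hself,
    abs_le] at hcs
  refine le_of_mul_le_mul_left ?_ hpos
  rcases max_choice (a - m) (m - b) with h | h <;> rw [h] <;> nlinarith

variable (T : H →L[ℂ] K)

/-- With `m` the midpoint and `h` the half-length of `[a, b]`, the operator
`R = Q_[c, d] T P_[a, b]` satisfies `k ‖R‖ ≤ h ‖R‖` for some `k > h`. -/
theorem proj_Icc_map_proj_Icc_eq_zero (hA : P.IsSpectralMeasureOf A)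
    (hB : Q.IsSpectralMeasureOf B) (hT : ∀ p ∈ A.graph, (T p.1, T p.2) ∈ B.graph) {a b c d : ℝ}
    (hab : a < b) (hd : b < c ∨ d < a) (x : H) :
    Q.proj (Set.Icc c d) (T (P.proj (Set.Icc a b) x)) = 0 := by
  set m := (a + b) / 2 with hm
  set k := max (c - m) (m - d) with hk
  set R : H →L[ℂ] K := Q.proj (Set.Icc c d) ∘L T ∘L P.proj (Set.Icc a b) with hR
  have hlt : (b - a) / 2 < k := by
    rw [hk, lt_max_iff]
    exact hd.imp (fun _ => by linarith) fun _ => by linarith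
  have hbound : ∀ z, k * ‖R z‖ ≤ ‖R‖ * ((b - a) / 2 * ‖z‖) := fun z => by
    obtain ⟨w, hw⟩ := hA.exists_mem_graph_proj_Icc (a := a) (b := b) z
    have hproj := P.proj_proj_self (measurableSet_Icc (a := a) (b := b)) z
    have hupper := hA.norm_sub_midpoint_smul_le hw hab hproj
    have hlower := hB.mul_norm_le_norm_sub_smul
      (hB.proj_mem_graph (hT _ hw) (measurableSet_Icc (a := c) (b := d))) m
      (Q.proj_proj_self measurableSet_Icc _)
    have hRw : Q.proj (Set.Icc c d) (T w) -
        (m : ℂ) • Q.proj (Set.Icc c d) (T (P.proj (Set.Icc a b) z)) =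
        R (w - (m : ℂ) • P.proj (Set.Icc a b) z) := by
      simp only [hR, ContinuousLinearMap.comp_apply, map_sub, map_smul, hproj,
        hA.proj_snd_eq_self hw measurableSet_Icc hproj]
    calc k * ‖R z‖ ≤ ‖R (w - (m : ℂ) • P.proj (Set.Icc a b) z)‖ := hRw ▸ hlower
      _ ≤ ‖R‖ * ((b - a) / 2 * ‖P.proj (Set.Icc a b) z‖) := R.le_opNorm_of_le hupper
      _ ≤ ‖R‖ * ((b - a) / 2 * ‖z‖) := by
        have := P.norm_proj_apply_le (measurableSet_Icc (a := a) (b := b)) z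
        gcongr
  have hkpos : 0 < k := by linarith
  have hnorm : ‖R‖ ≤ (b - a) / 2 / k * ‖R‖ :=
    R.opNorm_le_bound (by positivity [sub_pos.mpr hab]) fun z => by
      rw [div_mul_eq_mul_div, div_mul_eq_mul_div, le_div_iff₀ hkpos]
      linarith [hbound z]
  have hone : (b - a) / 2 / k < 1 := (div_lt_one hkpos).mpr hlt
  have hzero : R = 0 := norm_eq_zero.mp (by nlinarith [norm_nonneg R])
  exact congrArg (fun S : H →L[ℂ] K => S x) hzero

theorem proj_Ioi_map_proj_Iic_eq_zero (hA : P.IsSpectralMeasureOf A)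
    (hB : Q.IsSpectralMeasureOf B) (hT : ∀ p ∈ A.graph, (T p.1, T p.2) ∈ B.graph) (c : ℝ) (x : H) :
    Q.proj (Set.Ioi c) (T (P.proj (Set.Iic c) x)) = 0 := by
  have hIcc (n : ℕ) : Q.proj (Set.Icc (c + 1 / ((n : ℝ) + 1)) (c + 2 + n))
      (T (P.proj (Set.Iic c) x)) = 0 := by
    have hlim := ((Q.proj (Set.Icc (c + 1 / ((n : ℝ) + 1)) (c + 2 + n)) ∘L T).continuous.tendsto
      _).comp (P.tendsto_proj_Iic c x)
    refine tendsto_nhds_unique (hlim.congr fun k => ?_) tendsto_const_nhds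
    exact hA.proj_Icc_map_proj_Icc_eq_zero T hB hT (by linarith [k.cast_nonneg (α := ℝ)])
      (Or.inl (lt_add_of_pos_right c (by positivity))) x
  exact tendsto_nhds_unique (Q.tendsto_proj_Ioi c _)
    (tendsto_const_nhds.congr fun n => (hIcc n).symm)

theorem proj_Iic_map_proj_Ioi_eq_zero (hA : P.IsSpectralMeasureOf A)
    (hB : Q.IsSpectralMeasureOf B) (hT : ∀ p ∈ A.graph, (T p.1, T p.2) ∈ B.graph) (c : ℝ) (x : H) :
    Q.proj (Set.Iic c) (T (P.proj (Set.Ioi c) x)) = 0 := by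
  have hIcc (n : ℕ) : Q.proj (Set.Icc (c - 1 - n) c) (T (P.proj (Set.Ioi c) x)) = 0 := by
    have hlim := ((Q.proj (Set.Icc (c - 1 - n) c) ∘L T).continuous.tendsto _).comp
      (P.tendsto_proj_Ioi c x)
    refine tendsto_nhds_unique (hlim.congr fun k => ?_) tendsto_const_nhds
    have hle : 1 / ((k : ℝ) + 1) ≤ 1 := by
      rw [div_le_one (by positivity)]
      linarith [k.cast_nonneg (α := ℝ)]
    exact hA.proj_Icc_map_proj_Icc_eq_zero T hB hT (by linarith [k.cast_nonneg (α := ℝ)])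
      (Or.inr (lt_add_of_pos_right c (by positivity))) x
  exact tendsto_nhds_unique (Q.tendsto_proj_Iic c _)
    (tendsto_const_nhds.congr fun n => (hIcc n).symm)

theorem proj_apply_map (hA : P.IsSpectralMeasureOf A) (hB : Q.IsSpectralMeasureOf B)
    (hT : ∀ p ∈ A.graph, (T p.1, T p.2) ∈ B.graph) {s : Set ℝ} (hs : MeasurableSet s) (x : H) :
    Q.proj s (T x) = T (P.proj s x) := by
  induction s, hs using MeasurableSpace.induction_on_inter (borel_eq_generateFrom_Iic ℝ)
    isPiSystem_Iic with
  | empty => simp [P.empty', Q.empty']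
  | basic t ht =>
    obtain ⟨c, rfl⟩ := ht
    have hIic := hA.proj_Iic_map_proj_Ioi_eq_zero T hB hT c x
    have hIoi := hA.proj_Ioi_map_proj_Iic_eq_zero T hB hT c x
    rw [← Set.compl_Iic, P.proj_compl measurableSet_Iic, map_sub, map_sub, sub_eq_zero] at hIic
    rw [← Set.compl_Iic, Q.proj_compl measurableSet_Iic, sub_eq_zero] at hIoi
    rw [hIic, ← hIoi]
  | compl t ht ih => rw [Q.proj_compl ht, P.proj_compl ht, ih, map_sub]
  | iUnion f hd hf ih =>
    have hd' : ∀ m n, m ≠ n → f m ∩ f n = ∅ := fun m n hmn =>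
      Set.disjoint_iff_inter_eq_empty.mp (hd hmn)
    refine tendsto_nhds_unique (Q.iUnion' f hf hd' (T x)) ?_
    simp only [ih, ← map_sum]
    exact (T.continuous.tendsto _).comp (P.iUnion' f hf hd' x)

theorem eq_of_isSpectralMeasureOf {P' : ProjectionValuedMeasure H} (hA : P.IsSpectralMeasureOf A)
    (hA' : P'.IsSpectralMeasureOf A) : P' = P :=
  ext_of_measurableSet fun _ hs => ContinuousLinearMap.ext fun x =>
    proj_apply_map (ContinuousLinearMap.id ℂ H) hA hA' (fun _ hp => hp) hs x

theorem scalarMeasure_map (hA : P.IsSpectralMeasureOf A) (hB : Q.IsSpectralMeasureOf B)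
    (u : H →ₗᵢ[ℂ] K) (hu : ∀ p ∈ A.graph, (u p.1, u p.2) ∈ B.graph) (x : H) :
    Q.scalarMeasure (u x) = P.scalarMeasure x := by
  ext s hs
  have hproj : Q.proj s (u x) = u (P.proj s x) :=
    proj_apply_map u.toContinuousLinearMap hA hB hu hs x
  rw [Q.scalarMeasure_apply hs, P.scalarMeasure_apply hs, hproj, u.norm_map]

end ProjectionValuedMeasure.IsSpectralMeasureOf

end SpectralMeasure

/-! ### The spectral theorem for a bounded self-adjoint operator -/

section CyclicIsometry

open Filter Topology MeasureTheory ContinuousLinearMap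

open scoped CompactlySupported

variable {H : Type*} [NormedAddCommGroup H] [InnerProductSpace ℂ H] [CompleteSpace H]
  {B : H →L[ℂ] H} (hB : IsSelfAdjoint B)

/-- The positive functional `f ↦ ⟪x, f(B) x⟫` on the continuous functions on the spectrum of `B`,
which represents the spectral measure of `B` at `x`. -/
noncomputable def spectralFunctional (x : H) : C_c(spectrum ℝ B, ℝ) →ₚ[ℝ] ℝ :=
  PositiveLinearMap.mk₀
    { toFun f := (⟪x, cfcHom hB f.toContinuousMap x⟫_ℂ).re
      map_add' f g := by
        have hadd : (f + g).toContinuousMap = f.toContinuousMap + g.toContinuousMap := rfl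
        rw [hadd, map_add, add_apply, inner_add_right, Complex.add_re]
      map_smul' c f := by
        have hsmul : (c • f).toContinuousMap = c • f.toContinuousMap := rfl
        rw [hsmul, map_smul, smul_apply, ← Complex.coe_smul, inner_smul_right,
          Complex.re_ofReal_mul]
        rfl }
    fun f hf => by
      have hpos : 0 ≤ cfcHom hB f.toContinuousMap := (cfcHom_nonneg_iff hB).mpr hf
      exact ((nonneg_iff_isPositive _).mp hpos).re_inner_nonneg_right x

/-- The spectral measure of the bounded self-adjoint operator `B` at the vector `x`, as a measure on
the spectrum of `B`. -/
noncomputable def scalarSpectralMeasure (x : H) : Measure (spectrum ℝ B) :=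
  RealRMK.rieszMeasure (spectralFunctional hB x)

instance (x : H) : IsFiniteMeasure (scalarSpectralMeasure hB x) :=
  inferInstanceAs (IsFiniteMeasure (RealRMK.rieszMeasure _))

theorem integrable_scalarSpectralMeasure {f : spectrum ℝ B → ℝ} (hf : Continuous f) (x : H) :
    Integrable f (scalarSpectralMeasure hB x) :=
  hf.integrable_of_hasCompactSupport (.of_compactSpace _)

theorem integral_scalarSpectralMeasure (f : C(spectrum ℝ B, ℝ)) (x : H) :
    ∫ t, f t ∂(scalarSpectralMeasure hB x) = (⟪x, cfcHom hB f x⟫_ℂ).re :=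
  RealRMK.integral_rieszMeasure (spectralFunctional hB x) ⟨f, .of_compactSpace _⟩

theorem inner_cfcHom_left (f : C(spectrum ℝ B, ℝ)) (x y : H) :
    ⟪cfcHom hB f x, y⟫_ℂ = ⟪x, cfcHom hB f y⟫_ℂ := by
  rw [← star_inner_left, ((IsSelfAdjoint.all f).map (cfcHom hB)).star_eq]

theorem norm_cfcHom_apply (f : C(spectrum ℝ B, ℝ)) (x : H) :
    ‖cfcHom hB f x‖ = ‖ContinuousMap.toLp 2 (scalarSpectralMeasure hB x) ℝ f‖ := by
  have hsq : (⟪cfcHom hB f x, cfcHom hB f x⟫_ℂ).re = (⟪x, cfcHom hB (f * f) x⟫_ℂ).re := by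
    rw [map_mul, mul_apply_eq_comp, inner_cfcHom_left]
  refine (sq_eq_sq₀ (norm_nonneg _) (norm_nonneg _)).mp ?_
  rw [← inner_self_eq_norm_sq (𝕜 := ℂ), ← real_inner_self_eq_norm_sq, ContinuousMap.inner_toLp]
  exact hsq.trans (integral_scalarSpectralMeasure hB (f * f) x).symm

theorem exists_cyclicIsometry (x : H) :
    ∃ V : Lp ℝ 2 (scalarSpectralMeasure hB x) →ₗᵢ[ℝ] H,
      ∀ f : C(spectrum ℝ B, ℝ), V (ContinuousMap.toLp 2 _ ℝ f) = cfcHom hB f x := by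
  let e := (ContinuousMap.toLp (E := ℝ) 2 (scalarSpectralMeasure hB x) ℝ).toLinearMap
  let f : C(spectrum ℝ B, ℝ) →ₗ[ℝ] H :=
    { toFun f := cfcHom hB f x
      map_add' f g := by rw [map_add, add_apply]
      map_smul' c f := by rw [map_smul, smul_apply, RingHom.id_apply] }
  have hdense : DenseRange e := ContinuousMap.toLp_denseRange ℝ _ ℝ (by simp)
  have hext : ∀ g, f.extendOfNorm e (e g) = f g := f.extendOfNorm_eq hdense
    ⟨1, fun g => by rw [one_mul]; exact (norm_cfcHom_apply hB g x).le⟩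
  refine ⟨⟨(f.extendOfNorm e).toLinearMap, fun F => ?_⟩, hext⟩
  refine hdense.induction_on (p := fun F => ‖f.extendOfNorm e F‖ = ‖F‖) F
    (isClosed_eq (by fun_prop) (by fun_prop)) fun g => ?_
  rw [hext]
  exact norm_cfcHom_apply hB g x

/-- The isometry from `L²` of the spectral measure of `B` at `x` onto the cyclic subspace of `x`; it
extends `f ↦ f(B) x` from continuous functions, so its values define `f(B) x` for `f` in `L²`. -/
noncomputable def cyclicIsometry (x : H) : Lp ℝ 2 (scalarSpectralMeasure hB x) →ₗᵢ[ℝ] H :=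
  (exists_cyclicIsometry hB x).choose

theorem cyclicIsometry_toLp (f : C(spectrum ℝ B, ℝ)) (x : H) :
    cyclicIsometry hB x (ContinuousMap.toLp 2 _ ℝ f) = cfcHom hB f x :=
  (exists_cyclicIsometry hB x).choose_spec f

theorem re_inner_cyclicIsometry (x : H) (F G : Lp ℝ 2 (scalarSpectralMeasure hB x)) :
    (⟪cyclicIsometry hB x F, cyclicIsometry hB x G⟫_ℂ).re = ⟪F, G⟫_ℝ := by
  let _ : InnerProductSpace ℝ H := .complexToReal
  exact (cyclicIsometry hB x).inner_map_map F G

theorem tendsto_toLp_of_tendsto_eLpNorm_sub {X : Type*} [TopologicalSpace X] [CompactSpace X]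
    [MeasurableSpace X] [BorelSpace X] {μ ν : Measure X} [IsFiniteMeasure μ] {f : X → ℝ} {p : ℝ≥0∞}
    [Fact (1 ≤ p)] {φ : ℕ → C(X, ℝ)} (hle : μ ≤ ν) (hf : MemLp f p μ)
    (hφ : Tendsto (fun n => eLpNorm (f - ⇑(φ n)) p ν) atTop (𝓝 0)) :
    Tendsto (fun n => (φ n).toLp p μ ℝ) atTop (𝓝 (hf.toLp f)) := by
  rw [Lp.tendsto_Lp_iff_tendsto_eLpNorm]
  refine tendsto_of_tendsto_of_tendsto_of_le_of_le tendsto_const_nhds hφ (fun _ => zero_le)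
    fun n => ?_
  rw [eLpNorm_sub_comm f]
  refine (eLpNorm_congr_ae ?_).trans_le (eLpNorm_mono_measure _ hle)
  exact (ContinuousMap.coeFn_toLp μ _).sub .rfl

theorem exists_seq_tendsto_toLp {X : Type*} [PseudoMetricSpace X] [CompactSpace X]
    [MeasurableSpace X] [BorelSpace X] {μ ν : Measure X} [IsFiniteMeasure μ] [IsFiniteMeasure ν]
    {f : X → ℝ} {p : ℝ≥0∞} [Fact (1 ≤ p)] (hp : p ≠ ∞) (hf : MemLp f p (μ + ν)) :
    ∃ φ : ℕ → C(X, ℝ),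
      Tendsto (fun n => (φ n).toLp p μ ℝ) atTop (𝓝 (hf.left_of_add_measure.toLp f)) ∧
      Tendsto (fun n => (φ n).toLp p ν ℝ) atTop (𝓝 (hf.right_of_add_measure.toLp f)) := by
  choose φ hφ _ using fun n : ℕ => hf.exists_boundedContinuous_eLpNorm_sub_le hp
    (ENNReal.inv_ne_zero.mpr (ENNReal.natCast_ne_top n))
  have hlim : Tendsto (fun n => eLpNorm (f - ⇑(φ n).toContinuousMap) p (μ + ν)) atTop (𝓝 0) :=
    tendsto_of_tendsto_of_tendsto_of_le_of_le tendsto_const_nhds ENNReal.tendsto_inv_nat_nhds_zero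
      (fun _ => zero_le) hφ
  exact ⟨fun n => (φ n).toContinuousMap,
    tendsto_toLp_of_tendsto_eLpNorm_sub (Measure.le_add_right le_rfl) _ hlim,
    tendsto_toLp_of_tendsto_eLpNorm_sub (Measure.le_add_left le_rfl) _ hlim⟩

theorem inner_cyclicIsometry_left {f : spectrum ℝ B → ℝ} {x y : H}
    (hf : MemLp f 2 (scalarSpectralMeasure hB x + scalarSpectralMeasure hB y)) :
    ⟪cyclicIsometry hB x (hf.left_of_add_measure.toLp f), y⟫_ℂ =
      ⟪x, cyclicIsometry hB y (hf.right_of_add_measure.toLp f)⟫_ℂ := by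
  obtain ⟨φ, hφx, hφy⟩ := exists_seq_tendsto_toLp (by simp) hf
  have hx := (((cyclicIsometry hB x).continuous.tendsto _).comp hφx).inner
    (tendsto_const_nhds (x := y)) (𝕜 := ℂ)
  have hy := (tendsto_const_nhds (x := x)).inner
    (((cyclicIsometry hB y).continuous.tendsto _).comp hφy) (𝕜 := ℂ)
  simp only [Function.comp_apply, cyclicIsometry_toLp, inner_cfcHom_left] at hx hy
  exact tendsto_nhds_unique hx hy

end CyclicIsometry

section SpectralProjection

open Filter Topology MeasureTheory ContinuousLinearMap

variable {H : Type*} [NormedAddCommGroup H] [InnerProductSpace ℂ H] [CompleteSpace H]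

theorem exists_isSelfAdjoint_of_inner_eq {f : H → H} (hf : ∀ x y, ⟪f x, y⟫_ℂ = ⟪x, f y⟫_ℂ) :
    ∃ T : H →L[ℂ] H, IsSelfAdjoint T ∧ ∀ x, T x = f x := by
  let T : H →ₗ[ℂ] H :=
    { toFun := f
      map_add' x y := ext_inner_right ℂ fun z => by simp only [inner_add_left, hf]
      map_smul' c x := ext_inner_right ℂ fun z => by simp [inner_smul_left, hf, mul_comm] }
  have hT : T.IsSymmetric := hf
  exact ⟨hT.toSelfAdjoint, hT.toSelfAdjoint.2, fun _ => rfl⟩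

theorem eq_of_re_inner_eq {S T : H →L[ℂ] H} (hS : IsSelfAdjoint S) (hT : IsSelfAdjoint T)
    (h : ∀ x, (⟪S x, x⟫_ℂ).re = (⟪T x, x⟫_ℂ).re) : S = T := by
  refine coe_injective <| (ext_inner_map _ _).mp fun x => Complex.ext (h x) ?_
  have hS' := (isSelfAdjoint_iff_isSymmetric.mp hS).im_inner_apply_self x
  have hT' := (isSelfAdjoint_iff_isSymmetric.mp hT).im_inner_apply_self x
  exact hS'.trans hT'.symm

variable {B : H →L[ℂ] H} (hB : IsSelfAdjoint B)

theorem exists_spectralProjection {s : Set (spectrum ℝ B)} (hs : MeasurableSet s) :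
    ∃ T : H →L[ℂ] H, IsSelfAdjoint T ∧
      ∀ x, T x = cyclicIsometry hB x (indicatorConstLp 2 hs (measure_ne_top _ s) 1) :=
  exists_isSelfAdjoint_of_inner_eq fun _ _ =>
    inner_cyclicIsometry_left hB (memLp_indicator_const 2 hs 1 (.inr (measure_ne_top _ s)))

open Classical in
/-- The spectral projection `1_s(B)` of the bounded self-adjoint operator `B`; it is set to zero
when `s` is not measurable. -/
noncomputable def spectralProjection (s : Set (spectrum ℝ B)) : H →L[ℂ] H :=
  if hs : MeasurableSet s then (exists_spectralProjection hB hs).choose else 0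

variable {s t : Set (spectrum ℝ B)}

theorem spectralProjection_apply (hs : MeasurableSet s) (x : H) : spectralProjection hB s x =
    cyclicIsometry hB x (indicatorConstLp 2 hs (measure_ne_top _ s) 1) := by
  rw [spectralProjection, dif_pos hs]
  exact (exists_spectralProjection hB hs).choose_spec.2 x

theorem isSelfAdjoint_spectralProjection (hs : MeasurableSet s) :
    IsSelfAdjoint (spectralProjection hB s) := by
  rw [spectralProjection, dif_pos hs]
  exact (exists_spectralProjection hB hs).choose_spec.1

theorem spectralProjection_univ : spectralProjection hB Set.univ = 1 := by
  ext x
  rw [spectralProjection_apply hB .univ]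
  have hone : indicatorConstLp 2 .univ (measure_ne_top (scalarSpectralMeasure hB x) _) (1 : ℝ) =
      ContinuousMap.toLp 2 _ ℝ 1 := by
    refine Lp.ext (indicatorConstLp_coeFn.trans ?_)
    rw [Set.indicator_univ]
    exact (ContinuousMap.coeFn_toLp _ (1 : C(spectrum ℝ B, ℝ))).symm
  rw [hone, cyclicIsometry_toLp, map_one]

theorem re_inner_spectralProjection_spectralProjection (hs : MeasurableSet s)
    (ht : MeasurableSet t) (x : H) : (⟪spectralProjection hB s x, spectralProjection hB t x⟫_ℂ).re =
      (scalarSpectralMeasure hB x).real (s ∩ t) := by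
  rw [spectralProjection_apply hB hs, spectralProjection_apply hB ht, re_inner_cyclicIsometry,
    L2.real_inner_indicatorConstLp_one_indicatorConstLp_one]

theorem norm_spectralProjection_sq (hs : MeasurableSet s) (x : H) :
    ‖spectralProjection hB s x‖ ^ 2 = (scalarSpectralMeasure hB x).real s := by
  have hinner := re_inner_spectralProjection_spectralProjection hB hs hs x
  rw [Set.inter_self] at hinner
  exact (inner_self_eq_norm_sq (𝕜 := ℂ) _).symm.trans hinner

theorem re_inner_spectralProjection_self (hs : MeasurableSet s) (x : H) :
    (⟪spectralProjection hB s x, x⟫_ℂ).re = (scalarSpectralMeasure hB x).real s := by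
  simpa [spectralProjection_univ] using
    re_inner_spectralProjection_spectralProjection hB hs .univ x

theorem isIdempotentElem_spectralProjection (hs : MeasurableSet s) :
    IsIdempotentElem (spectralProjection hB s) := by
  have hE := isSelfAdjoint_spectralProjection hB hs
  refine eq_of_re_inner_eq (by rw [IsSelfAdjoint, star_mul, hE.star_eq]) hE fun x => ?_
  rw [re_inner_spectralProjection_self hB hs, mul_apply_eq_comp, ← hE.star_eq, star_inner_left,
    hE.star_eq, re_inner_spectralProjection_spectralProjection hB hs hs, Set.inter_self]

theorem spectralProjection_union (hs : MeasurableSet s) (ht : MeasurableSet t)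
    (hst : Disjoint s t) :
    spectralProjection hB (s ∪ t) = spectralProjection hB s + spectralProjection hB t := by
  ext x
  rw [add_apply, spectralProjection_apply hB (hs.union ht), spectralProjection_apply hB hs,
    spectralProjection_apply hB ht, ← map_add, indicatorConstLp_disjoint_union hs ht _ _ hst]

theorem spectralProjection_mul_of_disjoint (hs : MeasurableSet s) (ht : MeasurableSet t)
    (hst : Disjoint s t) : spectralProjection hB s * spectralProjection hB t = 0 := by
  have hs' := isIdempotentElem_spectralProjection hB hs
  have hunion := isIdempotentElem_spectralProjection hB (hs.union ht)
  rw [spectralProjection_union hB hs ht hst,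
    hs'.add_iff (isIdempotentElem_spectralProjection hB ht)] at hunion
  have : IsAddTorsionFree (H →L[ℂ] H) := .of_isTorsionFree ℂ _
  exact hs'.mul_eq_zero_of_anticommute hunion

theorem spectralProjection_mul (hs : MeasurableSet s) (ht : MeasurableSet t) :
    spectralProjection hB s * spectralProjection hB t = spectralProjection hB (s ∩ t) := by
  have hst := hs.inter ht
  have hs_split := spectralProjection_union hB hst (hs.diff ht) Set.disjoint_sdiff_inter.symm
  have ht_split := spectralProjection_union hB hst (ht.diff hs) (by tauto_set)
  rw [Set.inter_union_sdiff] at hs_split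
  rw [Set.inter_comm s t, Set.inter_union_sdiff, Set.inter_comm t s] at ht_split
  rw [hs_split, ht_split, add_mul, mul_add, mul_add,
    (isIdempotentElem_spectralProjection hB hst).eq,
    spectralProjection_mul_of_disjoint hB hst (ht.diff hs) (by tauto_set),
    spectralProjection_mul_of_disjoint hB (hs.diff ht) hst (by tauto_set),
    spectralProjection_mul_of_disjoint hB (hs.diff ht) (ht.diff hs) (by tauto_set)]
  simp only [add_zero]

end SpectralProjection

section SpectralProjectionLimits

open Filter Topology MeasureTheory ContinuousLinearMap

variable {H : Type*} [NormedAddCommGroup H] [InnerProductSpace ℂ H] [CompleteSpace H]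
  {B : H →L[ℂ] H} (hB : IsSelfAdjoint B)

theorem spectralProjection_empty : spectralProjection hB ∅ = 0 := by
  ext x
  rw [spectralProjection_apply hB .empty, indicatorConstLp_empty, map_zero, zero_apply]

theorem spectralProjection_biUnion {ι : Type*} {s : ι → Set (spectrum ℝ B)}
    (hs : ∀ i, MeasurableSet (s i)) (hd : Pairwise (Function.onFun Disjoint s)) (F : Finset ι) :
    spectralProjection hB (⋃ i ∈ F, s i) = ∑ i ∈ F, spectralProjection hB (s i) := by
  classical
  induction F using Finset.induction_on with
  | empty => simp [spectralProjection_empty]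
  | insert i F hi ih =>
    rw [Finset.set_biUnion_insert, Finset.sum_insert hi, ← ih]
    exact spectralProjection_union hB (hs i) (F.measurableSet_biUnion fun j _ => hs j)
      (Set.disjoint_iUnion₂_right.mpr fun j hj => hd fun hij => hi (hij ▸ hj))

theorem tendsto_sum_spectralProjection {s : ℕ → Set (spectrum ℝ B)}
    (hs : ∀ n, MeasurableSet (s n)) (hd : Pairwise (Function.onFun Disjoint s)) (x : H) :
    Tendsto (fun N : ℕ => ∑ n ∈ Finset.range N, spectralProjection hB (s n) x) atTop
      (𝓝 (spectralProjection hB (⋃ n, s n) x)) := by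
  have hU : ∀ N : ℕ, MeasurableSet (⋃ n ∈ Finset.range N, s n) := fun N =>
    (Finset.range N).measurableSet_biUnion fun n _ => hs n
  have htail : Tendsto (fun N : ℕ => scalarSpectralMeasure hB x
      (symmDiff (⋃ n ∈ Finset.range N, s n) (⋃ n, s n))) atTop (𝓝 0) := by
    refine tendsto_of_tendsto_of_tendsto_of_le_of_le tendsto_const_nhds
      (tendsto_measure_biUnion_Ici_zero_of_pairwise_disjoint
        (fun n => (hs n).nullMeasurableSet) hd) (fun _ => zero_le) fun N => measure_mono ?_
    rintro t (⟨ht, ht'⟩ | ⟨ht, ht'⟩)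
    · exact absurd (Set.iUnion₂_subset_iUnion _ _ ht) ht'
    · obtain ⟨n, hn⟩ := Set.mem_iUnion.mp ht
      refine Set.mem_biUnion (x := n) (Set.mem_Ici.mpr (not_lt.mp fun hnN => ht' ?_)) hn
      exact Set.mem_biUnion (x := n) (Finset.mem_coe.mpr (Finset.mem_range.mpr hnN)) hn
  simp only [← sum_apply, ← spectralProjection_biUnion hB hs hd, spectralProjection_apply hB (hU _),
    spectralProjection_apply hB (.iUnion hs)]
  exact ((cyclicIsometry hB x).continuous.tendsto _).comp
    (tendsto_indicatorConstLp_set (by simp) htail)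

theorem exists_projectionValuedMeasure_map {g : spectrum ℝ B → ℝ} (hg : Measurable g) :
    ∃ P : ProjectionValuedMeasure H,
      ∀ x, P.scalarMeasure x = (scalarSpectralMeasure hB x).map g := by
  classical
  let P : ProjectionValuedMeasure H :=
    { proj s := if MeasurableSet s then spectralProjection hB (g ⁻¹' s) else 0
      isStarProjection' s hs := by
        rw [if_pos hs]
        exact ⟨isIdempotentElem_spectralProjection hB (hg hs),
          isSelfAdjoint_spectralProjection hB (hg hs)⟩
      not_measurable' s hs := if_neg hs
      empty' := by rw [if_pos .empty, Set.preimage_empty, spectralProjection_empty]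
      univ' := by rw [if_pos .univ, Set.preimage_univ, spectralProjection_univ]
      inter' s t hs ht := by
        rw [if_pos hs, if_pos ht, if_pos (hs.inter ht), spectralProjection_mul hB (hg hs) (hg ht),
          Set.preimage_inter]
      iUnion' s hs hd x := by
        simp only [if_pos (hs _), if_pos (MeasurableSet.iUnion hs), Set.preimage_iUnion]
        exact tendsto_sum_spectralProjection hB (fun n => hg (hs n)) (fun m n hmn =>
          (Set.disjoint_iff_inter_eq_empty.mpr (hd m n hmn)).preimage g) x }
  refine ⟨P, fun x => Measure.ext fun s hs => ?_⟩
  have hproj : P.proj s = spectralProjection hB (g ⁻¹' s) := if_pos hs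
  rw [P.scalarMeasure_apply hs, hproj, norm_spectralProjection_sq hB (hg hs), ofReal_measureReal,
    Measure.map_apply hg hs]

end SpectralProjectionLimits

section FunctionalCalculus

open Filter Topology MeasureTheory ContinuousLinearMap

variable {H : Type*} [NormedAddCommGroup H] [InnerProductSpace ℂ H] [CompleteSpace H]
  {B : H →L[ℂ] H} (hB : IsSelfAdjoint B)

theorem cfcHom_cyclicIsometry (φ : C(spectrum ℝ B, ℝ)) {f : spectrum ℝ B → ℝ} {x : H}
    (hf : MemLp f 2 (scalarSpectralMeasure hB x))
    (hφf : MemLp (⇑φ * f) 2 (scalarSpectralMeasure hB x)) :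
    cfcHom hB φ (cyclicIsometry hB x (hf.toLp f)) = cyclicIsometry hB x (hφf.toLp _) := by
  let μ := scalarSpectralMeasure hB x
  let m : Lp ℝ 2 μ →L[ℝ] Lp ℝ 2 μ := (mul ℝ ℝ).holderL μ ∞ 2 2 (φ.toLp ∞ μ ℝ)
  have hm : ∀ F, m F =ᵐ[μ] ⇑φ * ⇑F := fun F => by
    filter_upwards [(mul ℝ ℝ).coeFn_holder (r := 2) (φ.toLp ∞ μ ℝ) F,
      ContinuousMap.coeFn_toLp (p := ∞) (𝕜 := ℝ) μ φ] with t ht hφ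
    exact ht.trans (by rw [hφ]; rfl)
  have hcomm : ∀ F, cfcHom hB φ (cyclicIsometry hB x F) = cyclicIsometry hB x (m F) := fun F =>
    (ContinuousMap.toLp_denseRange ℝ μ ℝ (by simp)).induction_on F
      (isClosed_eq (by fun_prop) (by fun_prop)) fun ψ => by
        have hψ : m (ψ.toLp 2 μ ℝ) = (φ * ψ).toLp 2 μ ℝ := by
          refine Lp.ext ((hm _).trans ?_)
          filter_upwards [ContinuousMap.coeFn_toLp (p := 2) (𝕜 := ℝ) μ ψ,
            ContinuousMap.coeFn_toLp (p := 2) (𝕜 := ℝ) μ (φ * ψ)] with t ht ht'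
          rw [ht', Pi.mul_apply, ht, ContinuousMap.mul_apply]
        rw [hψ, cyclicIsometry_toLp, cyclicIsometry_toLp, map_mul, mul_apply_eq_comp]
  rw [hcomm]
  congr 1
  refine Lp.ext ((hm _).trans ?_)
  filter_upwards [hf.coeFn_toLp, hφf.coeFn_toLp] with t ht ht'
  rw [ht', Pi.mul_apply, ht, Pi.mul_apply]

theorem cyclicIsometry_id_mul {f : spectrum ℝ B → ℝ} {x : H}
    (hf : MemLp f 2 (scalarSpectralMeasure hB x))
    (htf : MemLp (fun t : spectrum ℝ B => (t : ℝ) * f t) 2 (scalarSpectralMeasure hB x)) :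
    B (cyclicIsometry hB x (hf.toLp f)) = cyclicIsometry hB x (htf.toLp _) := by
  have h := cfcHom_cyclicIsometry hB (.restrict (spectrum ℝ B) (.id ℝ)) hf htf
  rwa [cfcHom_id] at h

theorem apply_spectralProjection_zero (x : H) :
    B (spectralProjection hB {t | (t : ℝ) = 0} x) = 0 := by
  have hs : MeasurableSet {t : spectrum ℝ B | (t : ℝ) = 0} :=
    measurableSet_eq_fun (by fun_prop) (by fun_prop)
  have hzero : (fun t : spectrum ℝ B => (t : ℝ) *
      Set.indicator {t : spectrum ℝ B | (t : ℝ) = 0} (fun _ => (1 : ℝ)) t) = 0 := by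
    ext t
    by_cases ht : (t : ℝ) = 0 <;> simp [ht]
  rw [spectralProjection_apply hB hs, indicatorConstLp,
    cyclicIsometry_id_mul hB _ (by rw [hzero]; exact .zero)]
  simp only [hzero, MemLp.toLp_zero, map_zero]

theorem mem_range_of_memLp_inv (hinj : ∀ w, B w = 0 → w = 0) {x : H}
    (hx : MemLp (fun t : spectrum ℝ B => (t : ℝ)⁻¹) 2 (scalarSpectralMeasure hB x)) :
    ∃ w, B w = x := by
  let s := {t : spectrum ℝ B | (t : ℝ) = 0}
  have hs : MeasurableSet s := measurableSet_eq_fun (by fun_prop) (by fun_prop)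
  have hcompl : spectralProjection hB sᶜ x = x := by
    have hunion := spectralProjection_union hB hs hs.compl disjoint_compl_right
    rw [Set.union_compl_self, spectralProjection_univ] at hunion
    have hzero : spectralProjection hB s x = 0 := hinj _ (apply_spectralProjection_zero hB x)
    rw [← sub_eq_iff_eq_add'.mpr hunion, sub_apply, hzero, sub_zero, one_apply_eq_self]
  have hone : (fun t : spectrum ℝ B => (t : ℝ) * (t : ℝ)⁻¹) = sᶜ.indicator fun _ => 1 := by
    ext t
    by_cases ht : (t : ℝ) = 0 <;> simp [s, ht]
  have hmem : MemLp (fun t : spectrum ℝ B => (t : ℝ) * (t : ℝ)⁻¹) 2 (scalarSpectralMeasure hB x) :=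
    hone ▸ memLp_indicator_const 2 hs.compl 1 (.inr (measure_ne_top _ _))
  refine ⟨cyclicIsometry hB x (hx.toLp _), ?_⟩
  rw [cyclicIsometry_id_mul hB hx hmem]
  refine Eq.trans ?_ hcompl
  rw [spectralProjection_apply hB hs.compl]
  simp only [hone, indicatorConstLp]

theorem scalarSpectralMeasure_apply (w : H) : scalarSpectralMeasure hB (B w) =
    (scalarSpectralMeasure hB w).withDensity fun t => ENNReal.ofReal ((t : ℝ) ^ 2) := by
  have hfin : IsFiniteMeasure
      ((scalarSpectralMeasure hB w).withDensity fun t => ENNReal.ofReal ((t : ℝ) ^ 2)) :=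
    isFiniteMeasure_withDensity_ofReal
      (integrable_scalarSpectralMeasure hB (by fun_prop) w).hasFiniteIntegral
  refine ext_of_forall_integral_eq_of_IsFiniteMeasure fun f => ?_
  rw [integral_withDensity_eq_integral_toReal_smul (by fun_prop)
    (Eventually.of_forall fun t => ENNReal.ofReal_lt_top)]
  let i : C(spectrum ℝ B, ℝ) := .restrict (spectrum ℝ B) (.id ℝ)
  have hi : cfcHom hB i = B := cfcHom_id hB
  calc ∫ t, f t ∂(scalarSpectralMeasure hB (B w))
      = (⟪B w, cfcHom hB f.toContinuousMap (B w)⟫_ℂ).re :=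
        integral_scalarSpectralMeasure hB f.toContinuousMap (B w)
    _ = (⟪w, cfcHom hB (i * (f.toContinuousMap * i)) w⟫_ℂ).re := by
        rw [map_mul, map_mul, mul_apply_eq_comp, mul_apply_eq_comp,
          ← inner_cfcHom_left hB i, hi]
    _ = ∫ t, (i * (f.toContinuousMap * i)) t ∂(scalarSpectralMeasure hB w) :=
        (integral_scalarSpectralMeasure hB _ w).symm
    _ = ∫ t, (ENNReal.ofReal ((t : ℝ) ^ 2)).toReal • f t ∂(scalarSpectralMeasure hB w) := by
        refine integral_congr_ae (.of_forall fun t => ?_)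
        change (t : ℝ) * (f t * t) = (ENNReal.ofReal ((t : ℝ) ^ 2)).toReal • f t
        rw [ENNReal.toReal_ofReal (sq_nonneg _), smul_eq_mul]
        ring

end FunctionalCalculus

section InverseCalculus

open MeasureTheory ContinuousLinearMap

variable {H : Type*} [NormedAddCommGroup H] [InnerProductSpace ℂ H] [CompleteSpace H]
  {B : H →L[ℂ] H} (hB : IsSelfAdjoint B)

theorem lintegral_inv_sub_one_sq_lt_top (w : H) :
    ∫⁻ t, ENNReal.ofReal (((t : ℝ)⁻¹ - 1) ^ 2) ∂(scalarSpectralMeasure hB (B w)) < ∞ := by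
  rw [scalarSpectralMeasure_apply, lintegral_withDensity_eq_lintegral_mul _ (by fun_prop)
    (by fun_prop)]
  refine lt_of_le_of_lt (lintegral_mono fun t => ?_) (integrable_scalarSpectralMeasure hB
    (f := fun t => (1 - (t : ℝ)) ^ 2) (by fun_prop) w).lintegral_lt_top
  rw [Pi.mul_apply, ← ENNReal.ofReal_mul (sq_nonneg _)]
  refine ENNReal.ofReal_le_ofReal ?_
  rcases eq_or_ne (t : ℝ) 0 with ht | ht
  · simp [ht]
  · refine le_of_eq ?_
    field_simp

theorem memLp_inv_of_lintegral_inv_sub_one_sq_lt_top {x : H}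
    (hx : ∫⁻ t, ENNReal.ofReal (((t : ℝ)⁻¹ - 1) ^ 2) ∂(scalarSpectralMeasure hB x) < ∞) :
    MemLp (fun t : spectrum ℝ B => (t : ℝ)⁻¹) 2 (scalarSpectralMeasure hB x) := by
  have hsub : MemLp (fun t : spectrum ℝ B => (t : ℝ)⁻¹ - 1) 2 (scalarSpectralMeasure hB x) := by
    rw [memLp_two_iff_integrable_sq (by fun_prop)]
    exact ⟨by fun_prop, (hasFiniteIntegral_iff_ofReal (.of_forall fun t => sq_nonneg _)).mpr hx⟩
  exact (memLp_congr_ae (.of_forall fun t => sub_add_cancel _ _)).mp (hsub.add (memLp_const 1))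

theorem integral_inv_sub_one (w : H) :
    ∫ t, ((t : ℝ)⁻¹ - 1) ∂(scalarSpectralMeasure hB (B w)) = (⟪B w, w - B w⟫_ℂ).re := by
  let i : C(spectrum ℝ B, ℝ) := .restrict (spectrum ℝ B) (.id ℝ)
  have hi : cfcHom hB i = B := cfcHom_id hB
  calc ∫ t, ((t : ℝ)⁻¹ - 1) ∂(scalarSpectralMeasure hB (B w))
      = ∫ t, (ENNReal.ofReal ((t : ℝ) ^ 2)).toReal • ((t : ℝ)⁻¹ - 1)
          ∂(scalarSpectralMeasure hB w) := by
        rw [scalarSpectralMeasure_apply, integral_withDensity_eq_integral_toReal_smul (by fun_prop)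
          (.of_forall fun t => ENNReal.ofReal_lt_top)]
    _ = ∫ t, (i * (1 - i)) t ∂(scalarSpectralMeasure hB w) := by
        refine integral_congr_ae (.of_forall fun t => ?_)
        change (ENNReal.ofReal ((t : ℝ) ^ 2)).toReal • ((t : ℝ)⁻¹ - 1) = (t : ℝ) * (1 - t)
        rw [ENNReal.toReal_ofReal (sq_nonneg _), smul_eq_mul]
        rcases eq_or_ne (t : ℝ) 0 with ht | ht
        · simp [ht]
        · field_simp
    _ = (⟪w, cfcHom hB (i * (1 - i)) w⟫_ℂ).re := integral_scalarSpectralMeasure hB _ w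
    _ = (⟪B w, w - B w⟫_ℂ).re := by
        rw [map_mul, mul_apply_eq_comp, ← inner_cfcHom_left hB i, map_sub, map_one, hi, sub_apply,
          one_apply_eq_self]

end InverseCalculus

/-! ### The spectral theorem for a positive operator -/

section PositiveOperator

variable {H : Type*} [NormedAddCommGroup H] [InnerProductSpace ℂ H]

theorem norm_le_norm_add_of_re_inner_nonneg {x y : H} (h : 0 ≤ (⟪x, y⟫_ℂ).re) :
    ‖x‖ ≤ ‖x + y‖ := by
  refine (sq_le_sq₀ (norm_nonneg _) (norm_nonneg _)).mp ?_
  have hsq : ‖x + y‖ ^ 2 = ‖x‖ ^ 2 + 2 * (⟪x, y⟫_ℂ).re + ‖y‖ ^ 2 := norm_add_sq (𝕜 := ℂ) x y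
  nlinarith [sq_nonneg ‖y‖]

/-- The bounded operator `B` is the inverse of `1 + A`. -/
def IsInverseOneAdd (B : H →L[ℂ] H) (A : H →ₗ.[ℂ] H) : Prop :=
  (∀ w, (B w, w - B w) ∈ A.graph) ∧ ∀ p ∈ A.graph, B (p.1 + p.2) = p.1

theorem exists_isInverseOneAdd {A : H →ₗ.[ℂ] H} (hpos : ∀ p ∈ A.graph, 0 ≤ (⟪p.1, p.2⟫_ℂ).re)
    (hsurj : ∀ w, ∃ p ∈ A.graph, p.1 + p.2 = w) : ∃ B : H →L[ℂ] H, IsInverseOneAdd B A := by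
  let sum : A.graph →ₗ[ℂ] H := (LinearMap.fst ℂ H H + LinearMap.snd ℂ H H).domRestrict A.graph
  have hnorm : ∀ p : A.graph, ‖(p : H × H).1‖ ≤ ‖sum p‖ := fun p =>
    norm_le_norm_add_of_re_inner_nonneg (hpos p p.2)
  have hinj : Function.Injective sum := by
    refine (injective_iff_map_eq_zero sum).mpr fun p hp => ?_
    have hfst : (p : H × H).1 = 0 :=
      norm_le_zero_iff.mp ((hnorm p).trans_eq (by rw [hp, norm_zero]))
    exact Subtype.ext (Prod.ext hfst (by simpa [sum, hfst] using hp))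
  let e : A.graph ≃ₗ[ℂ] H := .ofBijective sum
    ⟨hinj, fun w => let ⟨p, hp, hw⟩ := hsurj w; ⟨⟨p, hp⟩, hw⟩⟩
  let B : H →L[ℂ] H := (LinearMap.fst ℂ H H ∘ₗ A.graph.subtype ∘ₗ e.symm).mkContinuous 1 fun w => by
    rw [one_mul]
    exact (hnorm (e.symm w)).trans_eq (congrArg norm (e.apply_symm_apply w))
  refine ⟨B, fun w => ?_, fun p hp => ?_⟩
  · have hw : (e.symm w : H × H) = (B w, w - B w) :=
      Prod.ext rfl (eq_sub_iff_add_eq'.mpr (e.apply_symm_apply w))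
    exact hw ▸ (e.symm w).2
  · exact congrArg (fun q : A.graph => (q : H × H).1) (e.symm_apply_apply ⟨p, hp⟩)

namespace IsInverseOneAdd

variable {A : H →ₗ.[ℂ] H} {B : H →L[ℂ] H} (h : IsInverseOneAdd B A)
include h

theorem eq_zero {w : H} (hw : B w = 0) : w = 0 := by
  have hgraph := h.1 w
  rw [hw, sub_zero] at hgraph
  exact A.mem_graph_snd_inj hgraph A.graph.zero_mem rfl

theorem mem_domain_iff {x : H} : x ∈ A.domain ↔ ∃ w, B w = x := by
  rw [LinearPMap.mem_domain_iff]
  exact ⟨fun ⟨y, hy⟩ => ⟨x + y, h.2 _ hy⟩, fun ⟨w, hw⟩ => ⟨w - B w, hw ▸ h.1 w⟩⟩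

theorem isSelfAdjoint [CompleteSpace H] (him : ∀ p ∈ A.graph, (⟪p.1, p.2⟫_ℂ).im = 0) :
    IsSelfAdjoint B := by
  refine ContinuousLinearMap.isSelfAdjoint_iff_isSymmetric.mpr fun v w => ?_
  have hsymm := inner_fst_snd_eq_of_im_eq_zero him (h.1 v) (h.1 w)
  simp only [inner_sub_left, inner_sub_right] at hsymm
  simp only [ContinuousLinearMap.coe_coe]
  linear_combination hsymm

end IsInverseOneAdd

variable [CompleteSpace H]

open MeasureTheory in
theorem exists_isSpectralMeasureOf {A : H →ₗ.[ℂ] H}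
    (hpos : ∀ p ∈ A.graph, ∃ r : ℝ, 0 ≤ r ∧ ⟪p.1, p.2⟫_ℂ = r)
    (hsurj : ∀ w, ∃ p ∈ A.graph, p.1 + p.2 = w) :
    ∃ P : ProjectionValuedMeasure H, P.IsSpectralMeasureOf A := by
  have hre : ∀ p ∈ A.graph, 0 ≤ (⟪p.1, p.2⟫_ℂ).re ∧ (⟪p.1, p.2⟫_ℂ).im = 0 := fun p hp => by
    obtain ⟨r, hr, hpr⟩ := hpos p hp
    exact ⟨by rwa [hpr, Complex.ofReal_re], by rw [hpr, Complex.ofReal_im]⟩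
  obtain ⟨B, h⟩ := exists_isInverseOneAdd (fun p hp => (hre p hp).1) hsurj
  have hB := h.isSelfAdjoint fun p hp => (hre p hp).2
  have hg : Measurable fun t : spectrum ℝ B => (t : ℝ)⁻¹ - 1 := by fun_prop
  obtain ⟨P, hP⟩ := exists_projectionValuedMeasure_map hB hg
  refine ⟨P, fun x => ?_, fun ⟨x, hx⟩ => ?_⟩
  · rw [h.mem_domain_iff, hP, lintegral_map (by fun_prop) hg]
    exact ⟨fun ⟨w, hw⟩ => hw ▸ lintegral_inv_sub_one_sq_lt_top hB w, fun hfin =>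
      mem_range_of_memLp_inv hB (fun _ => h.eq_zero)
        (memLp_inv_of_lintegral_inv_sub_one_sq_lt_top hB hfin)⟩
  · obtain ⟨w, rfl⟩ := h.mem_domain_iff.mp hx
    have hA : A ⟨B w, hx⟩ = w - B w := A.mem_graph_snd_inj (A.mem_graph ⟨B w, hx⟩) (h.1 w) rfl
    rw [hP, integral_map hg.aemeasurable (by fun_prop), integral_inv_sub_one, hA]
    exact Complex.ext rfl (hre _ (h.1 w)).2

end PositiveOperator

/-! ### Invariance of the relative entropy -/

section RelativeEntropy

variable {H K : Type*} [NormedAddCommGroup H] [InnerProductSpace ℂ H] [CompleteSpace H]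
  [NormedAddCommGroup K] [InnerProductSpace ℂ K] [CompleteSpace K]
  {M : VonNeumannAlgebra H} {N : VonNeumannAlgebra K} {Ψ Φ : H}

theorem exists_isSpectralMeasureOf_relativeModularOperator (h : IsCyclicVector M Ψ)
    (h' : IsCyclicVector M.commutant Ψ) : ∃ P : ProjectionValuedMeasure H,
      P.IsSpectralMeasureOf (relativeModularOperator M Ψ Φ) := by
  refine exists_isSpectralMeasureOf (fun p hp => ?_) fun w => ?_
  · rw [graph_relativeModularOperator h h'] at hp
    exact exists_inner_eq_of_mem_relativeModularGraph hp
  · rw [graph_relativeModularOperator h h']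
    exact exists_mem_relativeModularGraph_add_eq M Ψ Φ w

theorem ProjectionValuedMeasure.IsSpectralMeasureOf.isRelativeEntropy
    {P : ProjectionValuedMeasure H}
    (hP : P.IsSpectralMeasureOf (relativeModularOperator M Ψ Φ)) (hcyc : IsCyclicVector M Ψ)
    (hsep : IsSeparatingVector M Ψ) : IsRelativeEntropy M Ψ Φ (-P.logIntegral Ψ) :=
  ⟨hcyc, hsep, P, hP, fun _ hQ => hP.eq_of_isSpectralMeasureOf hQ, rfl⟩

theorem exists_isRelativeEntropy_map (u : H →ₗᵢ[ℂ] K)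
    (hu : Reconstructs u.toContinuousLinearMap M N)
    (hu' : Reconstructs u.toContinuousLinearMap M.commutant N.commutant)
    (hM : IsCyclicVector M Ψ) (hM' : IsSeparatingVector M Ψ)
    (hN : IsCyclicVector N (u Ψ)) (hN' : IsSeparatingVector N (u Ψ)) :
    ∃ s : EReal, IsRelativeEntropy M Ψ Φ s ∧ IsRelativeEntropy N (u Ψ) (u Φ) s := by
  have hMc := hM'.isCyclicVector_commutant
  have hNc := hN'.isCyclicVector_commutant
  obtain ⟨P, hP⟩ := exists_isSpectralMeasureOf_relativeModularOperator (Φ := Φ) hM hMc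
  obtain ⟨Q, hQ⟩ := exists_isSpectralMeasureOf_relativeModularOperator (Φ := u Φ) hN hNc
  have hintertwine : ∀ p ∈ (relativeModularOperator M Ψ Φ).graph,
      (u p.1, u p.2) ∈ (relativeModularOperator N (u Ψ) (u Φ)).graph := by
    rw [graph_relativeModularOperator hM hMc, graph_relativeModularOperator hN hNc]
    exact fun _ hp => hu.map_mem_relativeModularGraph hu' hM hMc hp
  have hlog : Q.logIntegral (u Ψ) = P.logIntegral Ψ := by
    simp only [ProjectionValuedMeasure.logIntegral, hP.scalarMeasure_map hQ u hintertwine Ψ]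
  exact ⟨-P.logIntegral Ψ, hP.isRelativeEntropy hM hM', hlog ▸ hQ.isRelativeEntropy hN hN'⟩

end RelativeEntropy

theorem theorem2 {Hcode Hphys : Type*}
    [NormedAddCommGroup Hcode] [InnerProductSpace ℂ Hcode] [CompleteSpace Hcode]
    [NormedAddCommGroup Hphys] [InnerProductSpace ℂ Hphys] [CompleteSpace Hphys]
    (u : Hcode →ₗᵢ[ℂ] Hphys) (Mcode : VonNeumannAlgebra Hcode) (Mphys : VonNeumannAlgebra Hphys)
    (hΩ : ∃ Ω : Hcode, IsCyclicVector Mphys (u Ω) ∧ IsSeparatingVector Mphys (u Ω))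
    (hrec : ∀ O ∈ Mcode, ∀ O' ∈ Mcode.commutant,
      ∃ T ∈ Mphys, ∃ T' ∈ Mphys.commutant, ∀ Θ : Hcode,
        u (O Θ) = T (u Θ) ∧ u (O' Θ) = T' (u Θ) ∧
        u ((star O) Θ) = (star T) (u Θ) ∧ u ((star O') Θ) = (star T') (u Θ))
    (Ψ Φ : Hcode) (hcyc : IsCyclicVector Mcode Ψ) (hsep : IsSeparatingVector Mcode Ψ) :
    (IsCyclicVector Mphys (u Ψ) ∧ IsSeparatingVector Mphys (u Ψ) ∧
      IsCyclicVector Mphys.commutant (u Ψ) ∧ IsSeparatingVector Mphys.commutant (u Ψ)) ∧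
    (∃ s : EReal, IsRelativeEntropy Mcode Ψ Φ s ∧ IsRelativeEntropy Mphys (u Ψ) (u Φ) s) ∧
    (∃ s' : EReal, IsRelativeEntropy Mcode.commutant Ψ Φ s' ∧
      IsRelativeEntropy Mphys.commutant (u Ψ) (u Φ) s') := by
  obtain ⟨Ω, hΩcyc, hΩsep⟩ := hΩ
  have hu : Reconstructs u.toContinuousLinearMap Mcode Mphys := fun O hO =>
    let ⟨T, hT, _, _, h⟩ := hrec O hO 0 (zero_mem _)
    ⟨T, hT, fun x => ⟨(h x).1, (h x).2.2.1⟩⟩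
  have hu' : Reconstructs u.toContinuousLinearMap Mcode.commutant Mphys.commutant := fun O hO =>
    let ⟨_, _, T, hT, h⟩ := hrec 0 (zero_mem _) O hO
    ⟨T, hT, fun x => ⟨(h x).2.1, (h x).2.2.2⟩⟩
  have hu'' : Reconstructs u.toContinuousLinearMap Mcode.commutant.commutant
      Mphys.commutant.commutant := by
    simpa only [VonNeumannAlgebra.commutant_commutant] using hu
  have hcyc' := hsep.isCyclicVector_commutant
  have hsep' := hcyc.isSeparatingVector_commutant
  have hphys_sep : IsSeparatingVector Mphys (u Ψ) := hu'.isSeparatingVector_map hΩsep hcyc'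
  have hphys_sep' : IsSeparatingVector Mphys.commutant (u Ψ) :=
    hu''.isSeparatingVector_map hΩcyc.isSeparatingVector_commutant
      (by rwa [VonNeumannAlgebra.commutant_commutant])
  have hphys_cyc : IsCyclicVector Mphys (u Ψ) := hphys_sep'.isCyclicVector
  have hphys_cyc' := hphys_sep.isCyclicVector_commutant
  exact ⟨⟨hphys_cyc, hphys_sep, hphys_cyc', hphys_sep'⟩,
    exists_isRelativeEntropy_map u hu hu' hcyc hsep hphys_cyc hphys_sep,
    exists_isRelativeEntropy_map u hu' hu'' hcyc' hsep' hphys_cyc' hphys_sep'⟩
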